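/- Let $1<p<\infty$. There is a constant $C>0$, depending only on $p$, with the following property. Let $N\ge 1$, $0<s<1$, and let $\Omega\subset\mathbb R^N$ be an open set. Let $\mathcal D_0^{s,p}(\Omega)$ be the completion of $C_0^\infty(\Omega)$ (the smooth real functions with compact support in $\Omega$) with respect to the Gagliardo norm $$[u]_{s,p}=\Big(\iint_{\mathbb R^{2N}}\frac{|u(x)-u(y)|^p}{|x-y|^{N+sp}}\,dx\,dy\Big)^{1/p}.$$ Suppose that the inclusion $C_0^\infty(\Omega)\subset L^1(\Omega)$ extends to a compact linear operator $\mathcal D_0^{s,p}(\Omega)\hookrightarrow L^1(\Omega)$, by which the elements of $\mathcal D_0^{s,p}(\Omega)$ are regarded as functions in $L^1(\Omega)$, extended by $0$ to $\mathbb R^N\setminus\Omega$. Let $w$ be the $(s,p)$-torsion function on $\Omega$, i.e. the minimizer of $$v\mapsto \frac1p\,[v]_{s,p}^p-\int_\Omega v\,dx$$ among all $v\in\mathcal D_0^{s,p}(\Omega)$. Then, for all $u\in\mathcal D_0^{s,p}(\Omega)$, $$\int_\Omega\frac{|u|^p}{w^{p-1}}\,dx+2\int_{\mathbb R^N}\bigg(\int_{\mathbb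 R^N}\left|\frac{w(x)-w(y)}{w(x)+w(y)}\right|^p\frac{dy}{|x-y|^{N+sp}}\bigg)|u(x)|^p\,dx\le C\iint_{\mathbb R^{2N}}\frac{|u(x)-u(y)|^p}{|x-y|^{N+sp}}\,dx\,dy,$$ where the fraction $\frac{w(x)-w(y)}{w(x)+w(y)}$ is read as $0$ when $w(x)=w(y)=0$. -/

import Mathlib

open MeasureTheory TopologicalSpace Set
open scoped ENNReal NNReal Distributions

noncomputable section

namespace FracTorsion

/-- Euclidean `N`-space. -/
abbrev Euc (N : ℕ) : Type := EuclideanSpace ℝ (Fin N)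

/-- The integral `∬ |u(x) - u(y)| ^ p / |x - y| ^ (N + s p) dx dy` over `ℝ^N × ℝ^N`, as an element
of `[0, ∞]`. The integrand is `0` on the diagonal, since `0 / 0 = 0`. -/
def gagliardo {N : ℕ} (s p : ℝ) (u : Euc N → ℝ) : ℝ≥0∞ :=
  ∫⁻ z : Euc N × Euc N, ‖u z.1 - u z.2‖ₑ ^ p / ‖z.1 - z.2‖ₑ ^ ((N : ℝ) + s * p)

section Seminorm

variable {N : ℕ} {s p : ℝ}

/-- The radial majorant of the Gagliardo kernel for smooth compactly supported functions. -/
def majorant (N : ℕ) (s p : ℝ) (r : ℝ) : ℝ :=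
  if r < 1 then r ^ (p - (N + s * p)) else r ^ (-(N + s * p))

lemma integrable_majorant (hN : 1 ≤ N) (hs0 : 0 < s) (hs1 : s < 1) (hp : 1 < p) :
    Integrable (fun z : Euc N => majorant N s p ‖z‖) := by
  have : Nonempty (Fin N) := ⟨⟨0, hN⟩⟩
  have : Nontrivial (Euc N) := inferInstance
  rw [integrable_fun_norm_addHaar volume (f := majorant N s p), finrank_euclideanSpace_fin,
    ← Ioo_union_Ici_eq_Ioi (zero_lt_one (α := ℝ)), integrableOn_union]
  have hcast : ((N - 1 : ℕ) : ℝ) = N - 1 := by push_cast [Nat.cast_sub hN]; ring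
  have hsp : 0 < s * p := by positivity
  constructor
  · have h : IntegrableOn (fun r : ℝ => r ^ (p - s * p - 1)) (Ioo 0 1) := by
      rw [intervalIntegral.integrableOn_Ioo_rpow_iff one_pos]
      nlinarith
    refine h.congr_fun (fun r hr => ?_) measurableSet_Ioo
    simp only [majorant, hr.2, if_true, smul_eq_mul]
    rw [← Real.rpow_natCast, ← Real.rpow_add hr.1, hcast]
    congr 1; ring
  · rw [integrableOn_Ici_iff_integrableOn_Ioi]
    have h : IntegrableOn (fun r : ℝ => r ^ (-1 - s * p)) (Ioi 1) :=
      integrableOn_Ioi_rpow_of_lt (by linarith) one_pos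
    refine h.congr_fun (fun r hr => ?_) measurableSet_Ioi
    have hr1 : (1 : ℝ) < r := hr
    simp only [majorant, not_lt.2 hr1.le, if_false, smul_eq_mul]
    rw [← Real.rpow_natCast, ← Real.rpow_add (by linarith), hcast]
    congr 1; ring

/-- The Gagliardo integral of a smooth function with compact support is finite. -/
lemma gagliardo_lt_top (hs0 : 0 < s) (hs1 : s < 1) (hp : 1 < p) {u : Euc N → ℝ}
    (hu : ContDiff ℝ (⊤ : ℕ∞) u) (hc : HasCompactSupport u) : gagliardo s p u < ∞ := by
  have hp0 : 0 < p := by linarith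
  rcases Nat.eq_zero_or_pos N with rfl | hN
  · have h : ∀ z : Euc 0 × Euc 0, z.1 = z.2 := fun z => Subsingleton.elim _ _
    simp [gagliardo, h, hp0]
  obtain ⟨K, hK⟩ := hu.lipschitzWith_of_hasCompactSupport hc (by simp)
  obtain ⟨M, hM⟩ := hu.continuous.bounded_above_of_compact_support hc
  set S := tsupport u
  have hS : IsCompact S := hc
  have hM0 : 0 ≤ M := (norm_nonneg _).trans (hM 0)
  set L : ℝ := (K : ℝ) ^ p + (2 * M) ^ p
  have hL : 0 ≤ L := by positivity
  set A : Euc N → ℝ≥0∞ := fun z => ENNReal.ofReal (L * majorant N s p ‖z‖)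
  have hA : ∫⁻ z, A z < ∞ := ((integrable_majorant hN hs0 hs1 hp).const_mul L).lintegral_lt_top
  have hmaj : Measurable (majorant N s p) :=
    Measurable.ite measurableSet_Iio (by fun_prop) (by fun_prop)
  have hAm : Measurable A := by
    have := hmaj.comp (measurable_norm (α := Euc N))
    exact (this.const_mul L).ennreal_ofReal
  have hSm : MeasurableSet S := hS.isClosed.measurableSet
  have key : ∀ z : Euc N × Euc N, ‖u z.1 - u z.2‖ₑ ^ p / ‖z.1 - z.2‖ₑ ^ ((N : ℝ) + s * p) ≤
      S.indicator 1 z.1 * A (z.1 - z.2) + S.indicator 1 z.2 * A (z.1 - z.2) := by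
    rintro ⟨x, y⟩
    have hpt : ‖u x - u y‖ₑ ^ p / ‖x - y‖ₑ ^ ((N : ℝ) + s * p) ≤ A (x - y) := by
      rcases eq_or_ne x y with rfl | hxy
      · simp [hp0]
      have hr : 0 < ‖x - y‖ := norm_pos_iff.2 (sub_ne_zero.2 hxy)
      have h1 : ‖u x - u y‖ₑ ^ p / ‖x - y‖ₑ ^ ((N : ℝ) + s * p) =
          ENNReal.ofReal (‖u x - u y‖ ^ p / ‖x - y‖ ^ ((N : ℝ) + s * p)) := by
        rw [ENNReal.ofReal_div_of_pos (by positivity),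
          ← ENNReal.ofReal_rpow_of_nonneg (norm_nonneg _) hp0.le,
          ← ENNReal.ofReal_rpow_of_pos hr, ofReal_norm, ofReal_norm]
      rw [h1]
      apply ENNReal.ofReal_le_ofReal
      have hlip : ‖u x - u y‖ ≤ K * ‖x - y‖ := by
        simpa [dist_eq_norm] using hK.dist_le_mul x y
      have hbd : ‖u x - u y‖ ≤ 2 * M := by
        have := norm_sub_le (u x) (u y)
        linarith [hM x, hM y]
      unfold majorant
      split_ifs with h
      · rw [Real.rpow_sub hr, ← mul_div_assoc]
        gcongr
        calc ‖u x - u y‖ ^ p ≤ (K * ‖x - y‖) ^ p := by gcongr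
          _ = (K : ℝ) ^ p * ‖x - y‖ ^ p := Real.mul_rpow K.2 hr.le
          _ ≤ L * ‖x - y‖ ^ p := by
            gcongr
            exact le_add_of_nonneg_right (by positivity)
      · rw [Real.rpow_neg hr.le, ← div_eq_mul_inv]
        gcongr
        calc ‖u x - u y‖ ^ p ≤ (2 * M) ^ p := by gcongr
          _ ≤ L := le_add_of_nonneg_left (by positivity)
    by_cases hx : x ∈ S
    · refine hpt.trans (le_trans ?_ le_self_add)
      simp [hx]
    by_cases hy : y ∈ S
    · refine hpt.trans (le_trans ?_ le_add_self)
      simp [hy]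
    simp [image_eq_zero_of_notMem_tsupport hx, image_eq_zero_of_notMem_tsupport hy, hp0]
  have hS1 : Measurable (S.indicator (1 : Euc N → ℝ≥0∞)) := measurable_one.indicator hSm
  have hvol : volume S < ∞ := hS.measure_lt_top
  have e1 : ∫⁻ z : Euc N × Euc N, S.indicator 1 z.1 * A (z.1 - z.2) =
      volume S * ∫⁻ z, A z := by
    rw [Measure.volume_eq_prod, lintegral_prod _ (by fun_prop)]
    have : ∀ x : Euc N, ∫⁻ y, S.indicator 1 x * A (x - y) =
        S.indicator 1 x * ∫⁻ z, A z := fun x => by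
      rw [lintegral_const_mul _ (by fun_prop), lintegral_sub_left_eq_self A x]
    simp_rw [this]
    rw [lintegral_mul_const _ hS1, lintegral_indicator_one hSm]
  have e2 : ∫⁻ z : Euc N × Euc N, S.indicator 1 z.2 * A (z.1 - z.2) =
      volume S * ∫⁻ z, A z := by
    rw [Measure.volume_eq_prod, lintegral_prod_symm _ (by fun_prop)]
    have : ∀ y : Euc N, ∫⁻ x, S.indicator 1 y * A (x - y) =
        S.indicator 1 y * ∫⁻ z, A z := fun y => by
      rw [lintegral_const_mul _ (by fun_prop), lintegral_sub_right_eq_self A y]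
    simp_rw [this]
    rw [lintegral_mul_const _ hS1, lintegral_indicator_one hSm]
  calc gagliardo s p u ≤ ∫⁻ z : Euc N × Euc N,
        (S.indicator 1 z.1 * A (z.1 - z.2) + S.indicator 1 z.2 * A (z.1 - z.2)) :=
      lintegral_mono key
    _ = (volume S * ∫⁻ z, A z) + volume S * ∫⁻ z, A z := by
      rw [lintegral_add_left (by fun_prop), e1, e2]
    _ < ∞ := ENNReal.add_lt_top.2 ⟨ENNReal.mul_lt_top hvol hA, ENNReal.mul_lt_top hvol hA⟩

/-- Minkowski's inequality for the Gagliardo seminorm. -/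
lemma gagliardo_add_le (hp : 1 < p) {u v : Euc N → ℝ} (hu : Measurable u) (hv : Measurable v) :
    gagliardo s p (u + v) ^ (1 / p) ≤ gagliardo s p u ^ (1 / p) + gagliardo s p v ^ (1 / p) := by
  have hp0 : 0 < p := by linarith
  set q : (Euc N → ℝ) → Euc N × Euc N → ℝ≥0∞ :=
    fun u z => ‖u z.1 - u z.2‖ₑ / ‖z.1 - z.2‖ₑ ^ (((N : ℝ) + s * p) / p)
  have hq : ∀ u, gagliardo s p u = ∫⁻ z, q u z ^ p := fun u => by
    refine lintegral_congr fun z => ?_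
    rw [ENNReal.div_rpow_of_nonneg _ _ hp0.le, ← ENNReal.rpow_mul, div_mul_cancel₀ _ hp0.ne']
  have hm : ∀ u, Measurable u → Measurable (q u) := fun u hu => by
    have h1 : Measurable fun z : Euc N × Euc N => u z.1 - u z.2 :=
      (hu.comp measurable_fst).sub (hu.comp measurable_snd)
    exact h1.enorm.div (by fun_prop)
  rw [hq, hq u, hq v]
  refine le_trans ?_ (ENNReal.lintegral_Lp_add_le (hm u hu).aemeasurable (hm v hv).aemeasurable
    hp.le)
  gcongr with z
  rw [Pi.add_apply, ENNReal.div_add_div_same]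
  simp only [q, Pi.add_apply]
  gcongr
  rw [add_sub_add_comm]
  exact enorm_add_le _ _

lemma gagliardo_smul (hp : 1 < p) (c : ℝ) (u : Euc N → ℝ) (hu : Measurable u) :
    gagliardo s p (c • u) = ‖c‖ₑ ^ p * gagliardo s p u := by
  have hp0 : 0 < p := by linarith
  have h1 : Measurable fun z : Euc N × Euc N => u z.1 - u z.2 :=
    (hu.comp measurable_fst).sub (hu.comp measurable_snd)
  have h2 : Measurable fun z : Euc N × Euc N =>
      ‖u z.1 - u z.2‖ₑ ^ p / ‖z.1 - z.2‖ₑ ^ ((N : ℝ) + s * p) :=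
    (h1.enorm.pow_const p).div (by fun_prop)
  unfold gagliardo
  rw [← lintegral_const_mul _ h2]
  refine lintegral_congr fun z => ?_
  simp only [Pi.smul_apply]
  rw [← smul_sub, enorm_smul, ENNReal.mul_rpow_of_nonneg _ _ hp0.le, mul_div_assoc]

end Seminorm

/-- The space of smooth functions with compact support in the open set `Ω`, to be endowed with the
Gagliardo norm (and not with the usual topology of test functions). -/
@[nolint unusedArguments]
def GagliardoTest {N : ℕ} {s p : ℝ} (_hs0 : 0 < s) (_hs1 : s < 1) (_hp : 1 < p)
    (Ω : Opens (Euc N)) : Type :=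
  𝓓(Ω, ℝ)

namespace GagliardoTest

variable {N : ℕ} {s p : ℝ} {hs0 : 0 < s} {hs1 : s < 1} {hp : 1 < p} {Ω : Opens (Euc N)}

instance : AddCommGroup (GagliardoTest hs0 hs1 hp Ω) := inferInstanceAs (AddCommGroup 𝓓(Ω, ℝ))

instance : Module ℝ (GagliardoTest hs0 hs1 hp Ω) := inferInstanceAs (Module ℝ 𝓓(Ω, ℝ))

/-- The underlying function on `ℝ^N`. -/
def toFun (φ : GagliardoTest hs0 hs1 hp Ω) : Euc N → ℝ := TestFunction.toFun φ

lemma measurable_toFun (φ : GagliardoTest hs0 hs1 hp Ω) : Measurable φ.toFun :=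
  (TestFunction.contDiff' φ).continuous.measurable

lemma gagliardo_ne_top (φ : GagliardoTest hs0 hs1 hp Ω) : gagliardo s p φ.toFun ≠ ∞ :=
  (gagliardo_lt_top hs0 hs1 hp (TestFunction.contDiff' φ) (TestFunction.hasCompactSupport' φ)).ne

/-- The Gagliardo norm `[φ]_{s,p} = (∬ |φ(x) - φ(y)| ^ p / |x - y| ^ (N + s p) dx dy) ^ (1 / p)`. -/
instance : Norm (GagliardoTest hs0 hs1 hp Ω) where
  norm φ := (gagliardo s p φ.toFun).toReal ^ (1 / p)

lemma norm_def (φ : GagliardoTest hs0 hs1 hp Ω) :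
    ‖φ‖ = (gagliardo s p φ.toFun).toReal ^ (1 / p) := rfl

lemma core : SeminormedSpace.Core ℝ (GagliardoTest hs0 hs1 hp Ω) where
  norm_nonneg φ := by rw [norm_def]; positivity
  norm_smul c φ := by
    have hp0 : 0 < p := by linarith
    have h : (c • φ).toFun = c • φ.toFun := rfl
    rw [norm_def, norm_def, h, gagliardo_smul hp c _ φ.measurable_toFun, ENNReal.toReal_mul,
      Real.mul_rpow (by positivity) (by positivity), ← ENNReal.toReal_rpow, toReal_enorm,
      one_div, Real.rpow_rpow_inv (norm_nonneg _) hp0.ne']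
  norm_triangle φ ψ := by
    have hp0 : 0 < p := by linarith
    have h : (φ + ψ).toFun = φ.toFun + ψ.toFun := rfl
    have hf : ∀ χ : GagliardoTest hs0 hs1 hp Ω, gagliardo s p χ.toFun ^ (1 / p) ≠ ∞ := fun χ =>
      ENNReal.rpow_ne_top_of_nonneg (by positivity) χ.gagliardo_ne_top
    rw [norm_def, norm_def, norm_def, h, ENNReal.toReal_rpow, ENNReal.toReal_rpow,
      ENNReal.toReal_rpow, ← ENNReal.toReal_add (hf φ) (hf ψ)]
    exact ENNReal.toReal_mono (ENNReal.add_ne_top.2 ⟨hf φ, hf ψ⟩)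
      (gagliardo_add_le hp φ.measurable_toFun ψ.measurable_toFun)

instance : SeminormedAddCommGroup (GagliardoTest hs0 hs1 hp Ω) := SeminormedAddCommGroup.ofCore core

instance : NormedSpace ℝ (GagliardoTest hs0 hs1 hp Ω) where
  norm_smul_le c φ := (core.norm_smul c φ).le

end GagliardoTest

/-- The homogeneous fractional Sobolev space `D_0^{s,p}(Ω)`: the completion of the space of smooth
functions with compact support in `Ω` with respect to the Gagliardo norm. -/
abbrev D0 {N : ℕ} {s p : ℝ} (hs0 : 0 < s) (hs1 : s < 1) (hp : 1 < p) (Ω : Opens (Euc N)) : Type :=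
  UniformSpace.Completion (GagliardoTest hs0 hs1 hp Ω)

section Embedding

variable {N : ℕ} {s p : ℝ} {hs0 : 0 < s} {hs1 : s < 1} {hp : 1 < p} {Ω : Opens (Euc N)}

/-- `ι` is the compact embedding of `D_0^{s,p}(Ω)` into `L^1(Ω)`: the (unique) continuous linear
extension to the completion of the inclusion of the test functions in `L^1(Ω)`, and it is a compact
operator. -/
structure IsCompactEmbedding
    (ι : D0 hs0 hs1 hp Ω →L[ℝ] Lp ℝ 1 ((volume : Measure (Euc N)).restrict Ω)) : Prop where
  extends_inclusion : ∀ φ : GagliardoTest hs0 hs1 hp Ω,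
    ι (φ : D0 hs0 hs1 hp Ω) =ᵐ[(volume : Measure (Euc N)).restrict Ω] φ.toFun
  isCompactOperator : IsCompactOperator ι

/-- The function on `ℝ^N` represented by an element of `D_0^{s,p}(Ω)`, once `D_0^{s,p}(Ω)` is
embedded in `L^1(Ω)`; it is extended by zero outside `Ω`. -/
def rep (ι : D0 hs0 hs1 hp Ω →L[ℝ] Lp ℝ 1 ((volume : Measure (Euc N)).restrict Ω))
    (u : D0 hs0 hs1 hp Ω) : Euc N → ℝ :=
  (Ω : Set (Euc N)).indicator (ι u)

/-- `w` is the `(s,p)`-torsion function of `Ω`: it minimizes `(1 / p) [v]_{s,p} ^ p - ∫_Ω v dx`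
among all `v` in `D_0^{s,p}(Ω)`. Here `‖v‖ = [v]_{s,p}` is the norm of the completion. -/
def IsTorsionFunction (ι : D0 hs0 hs1 hp Ω →L[ℝ] Lp ℝ 1 ((volume : Measure (Euc N)).restrict Ω))
    (w : D0 hs0 hs1 hp Ω) : Prop :=
  ∀ v : D0 hs0 hs1 hp Ω,
    1 / p * ‖w‖ ^ p - ∫ x in Ω, rep ι w x ≤ 1 / p * ‖v‖ ^ p - ∫ x in Ω, rep ι v x

end Embedding

end FracTorsion

end

/-!
The torsion function `w` solves `(-Δ_p)^s w = 1` weakly, and the inequality is obtained by testing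
this equation against `|u| ^ p / (w + ε) ^ (p - 1)`, as for the classical Hardy inequality through
Picone's inequality. What makes the second weight appear is a pointwise Picone inequality with a
remainder (`exists_picone`): for positive `a, b` and nonnegative `A, B`,
`|a - b| ^ (p - 2) (a - b) (A ^ p / a ^ (p - 1) - B ^ p / b ^ (p - 1))
  + c (|a - b| / (a + b)) ^ p (A ^ p + B ^ p) ≤ C |A - B| ^ p`,
with `c` and `C` depending on `p` only. It follows from the convexity of `t ↦ t ^ p`, applied with
the weights `(1 + t) / 2` and `(1 - t) / 2`, `t` being the ratio of the smaller of `a, b` to the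
larger one. Integrating it with `a = w(x) + ε`, `b = w(y) + ε`, `A = |u(x)|`, `B = |u(y)|` and using
the symmetry of the kernel gives the regularized inequality for test functions `u`
(`IsTorsionFunction.regularized_hardy`). Fatou's lemma then removes `ε` and the smoothness of `u` at
once (`IsTorsionFunction.hardy`); in particular the positivity of `w` wherever some `u` is nonzero
need not be known beforehand.

The test function above is not smooth, and it need not be shown to lie in `D_0^{s,p}(Ω)`.
Mollification does not increase the Gagliardo energy (`gagliardo_convolution_le`) and preserves the
integral, so that `w` also minimizes the energy among integrable functions with compact support in
`Ω` (`IsTorsionFunction.le_of_integrable`), and hence, by density, among its own compactly supported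
perturbations (`IsTorsionFunction.le_add`). The first-order condition along such a perturbation is
the weak equation (`IsTorsionFunction.euler_lagrange`). The same minimality, applied to the absolute
values of test functions that approximate `w`, shows `∫ |w| ≤ ∫ w`, that is `w ≥ 0`
(`IsTorsionFunction.nonneg`). Elements of the abstract completion are handled through
`gagliardo_rep`: the norm of the completion is the Gagliardo seminorm of the represented function.
-/

namespace FracTorsion

open Filter Topology

/-! ### The Gagliardo energy as an `L^p` norm -/

section Energy

/-- The measure `|x - y| ^ (-e) dx dy` on `ℝ^N × ℝ^N`. For `e > 0` its density is `∞` on the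
diagonal, where all the functions integrated against it vanish. -/
noncomputable def kernelMeasure (N : ℕ) (e : ℝ) : Measure (Euc N × Euc N) :=
  (volume : Measure (Euc N × Euc N)).withDensity fun z => (‖z.1 - z.2‖ₑ ^ e)⁻¹

variable {N : ℕ} {s p : ℝ}

lemma lintegral_kernelMeasure (e : ℝ) {f : Euc N × Euc N → ℝ≥0∞} (hf : Measurable f) :
    ∫⁻ z, f z ∂(kernelMeasure N e) = ∫⁻ z, f z / ‖z.1 - z.2‖ₑ ^ e := by
  rw [kernelMeasure, lintegral_withDensity_eq_lintegral_mul _ (by fun_prop) hf]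
  refine lintegral_congr fun z => ?_
  rw [Pi.mul_apply, mul_comm, div_eq_mul_inv]

/-- The difference `(x, y) ↦ u(x) - u(y)`. -/
def diff (u : Euc N → ℝ) (z : Euc N × Euc N) : ℝ := u z.1 - u z.2

lemma measurable_diff {u : Euc N → ℝ} (hu : Measurable u) : Measurable (diff u) :=
  (hu.comp measurable_fst).sub (hu.comp measurable_snd)

lemma gagliardo_eq_lintegral {u : Euc N → ℝ} (hu : Measurable u) :
    gagliardo s p u = ∫⁻ z, ‖diff u z‖ₑ ^ p ∂(kernelMeasure N (N + s * p)) := by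
  rw [lintegral_kernelMeasure _ ((measurable_diff hu).enorm.pow_const p)]
  rfl

lemma ae_prod_of_ae {P : Euc N → Prop} (h : ∀ᵐ x, P x) :
    ∀ᵐ z : Euc N × Euc N, P z.1 ∧ P z.2 :=
  (Measure.quasiMeasurePreserving_fst.ae h).and (Measure.quasiMeasurePreserving_snd.ae h)

lemma gagliardo_congr_ae {u v : Euc N → ℝ} (h : u =ᵐ[volume] v) :
    gagliardo s p u = gagliardo s p v := by
  refine lintegral_congr_ae ?_
  filter_upwards [ae_prod_of_ae h] with z hz
  rw [hz.1, hz.2]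

lemma gagliardo_mono (hp : 0 < p) {u v : Euc N → ℝ} (h : ∀ x y, |u x - u y| ≤ |v x - v y|) :
    gagliardo s p u ≤ gagliardo s p v := by
  refine lintegral_mono fun z => ?_
  gcongr ?_ ^ p / _
  simpa [enorm_le_iff_norm_le] using h z.1 z.2

lemma gagliardo_sub_comm (u v : Euc N → ℝ) : gagliardo s p (u - v) = gagliardo s p (v - u) := by
  refine lintegral_congr fun z => ?_
  congr 2
  rw [← enorm_neg]
  congr 1
  simp only [Pi.sub_apply]
  ring

/-- Fatou's lemma for the Gagliardo energy. -/
lemma gagliardo_le_of_tendsto (hp : 0 < p) {u : ℕ → Euc N → ℝ} {v : Euc N → ℝ}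
    (hu : ∀ n, Measurable (u n)) (h : ∀ᵐ x, Tendsto (fun n => u n x) atTop (𝓝 (v x)))
    {a : ℕ → ℝ≥0∞} {b : ℝ≥0∞} (hab : Tendsto a atTop (𝓝 b))
    (hle : ∀ᶠ n in atTop, gagliardo s p (u n) ≤ a n) : gagliardo s p v ≤ b := by
  have key : ∀ᵐ z : Euc N × Euc N, ‖v z.1 - v z.2‖ₑ ^ p / ‖z.1 - z.2‖ₑ ^ ((N : ℝ) + s * p) =
      liminf (fun n => ‖u n z.1 - u n z.2‖ₑ ^ p / ‖z.1 - z.2‖ₑ ^ ((N : ℝ) + s * p)) atTop := by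
    filter_upwards [ae_prod_of_ae h] with z hz
    rcases eq_or_ne z.1 z.2 with h0 | h0
    · simp [h0, hp]
    refine (Tendsto.liminf_eq ?_).symm
    refine ENNReal.Tendsto.div_const ?_ (Or.inr ?_)
    · exact (ENNReal.continuous_rpow_const.tendsto _).comp ((hz.1.sub hz.2).enorm)
    · have : ‖z.1 - z.2‖ₑ ≠ 0 := by simpa [sub_eq_zero] using h0
      simp [ENNReal.rpow_eq_zero_iff, this]
  calc gagliardo s p v = _ := lintegral_congr_ae key
    _ ≤ liminf (fun n => gagliardo s p (u n)) atTop := by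
      refine lintegral_liminf_le fun n => ?_
      exact ((measurable_diff (hu n)).enorm.pow_const p).div (by fun_prop)
    _ ≤ liminf a atTop := liminf_le_liminf hle
    _ = b := hab.liminf_eq

lemma gagliardo_add_ne_top (hp : 1 < p) {u v : Euc N → ℝ} (hu : Measurable u) (hv : Measurable v)
    (hug : gagliardo s p u ≠ ∞) (hvg : gagliardo s p v ≠ ∞) : gagliardo s p (u + v) ≠ ∞ := by
  have hp0 : 0 < p := by linarith
  have hr : ∀ {a : ℝ≥0∞}, a ≠ ∞ → a ^ (1 / p) ≠ ∞ := fun h =>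
    ENNReal.rpow_ne_top_of_nonneg (by positivity) h
  have h := ne_top_of_le_ne_top (ENNReal.add_ne_top.2 ⟨hr hug, hr hvg⟩)
    (gagliardo_add_le (s := s) hp hu hv)
  have := ENNReal.rpow_ne_top_of_nonneg hp0.le h
  rwa [← ENNReal.rpow_mul, one_div_mul_cancel hp0.ne', ENNReal.rpow_one] at this

/-! ### Elements of the completion as functions -/

section Rep

variable {hs0 : 0 < s} {hs1 : s < 1} {hp : 1 < p} {Ω : Opens (Euc N)}
  {ι : D0 hs0 hs1 hp Ω →L[ℝ] Lp ℝ 1 ((volume : Measure (Euc N)).restrict Ω)}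

namespace GagliardoTest

lemma contDiff_toFun (φ : GagliardoTest hs0 hs1 hp Ω) : ContDiff ℝ (⊤ : ℕ∞) φ.toFun :=
  TestFunction.contDiff' φ

lemma hasCompactSupport_toFun (φ : GagliardoTest hs0 hs1 hp Ω) : HasCompactSupport φ.toFun :=
  TestFunction.hasCompactSupport' φ

lemma tsupport_toFun_subset (φ : GagliardoTest hs0 hs1 hp Ω) : tsupport φ.toFun ⊆ Ω :=
  TestFunction.tsupport_subset' φ

lemma toFun_eq_zero (φ : GagliardoTest hs0 hs1 hp Ω) {x : Euc N} (hx : x ∉ Ω) : φ.toFun x = 0 :=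
  image_eq_zero_of_notMem_tsupport fun h => hx (φ.tsupport_toFun_subset h)

lemma integrable_toFun (φ : GagliardoTest hs0 hs1 hp Ω) : Integrable φ.toFun :=
  φ.contDiff_toFun.continuous.integrable_of_hasCompactSupport φ.hasCompactSupport_toFun

lemma gagliardo_eq_norm (φ : GagliardoTest hs0 hs1 hp Ω) :
    gagliardo s p φ.toFun = ENNReal.ofReal (‖φ‖ ^ p) := by
  have hp0 : 0 < p := by linarith
  rw [norm_def, one_div, Real.rpow_inv_rpow (by positivity) hp0.ne',
    ENNReal.ofReal_toReal φ.gagliardo_ne_top]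

end GagliardoTest

lemma measurable_rep (u : D0 hs0 hs1 hp Ω) : Measurable (rep ι u) :=
  (Lp.stronglyMeasurable (ι u)).measurable.indicator Ω.isOpen.measurableSet

lemma rep_eq_zero (u : D0 hs0 hs1 hp Ω) {x : Euc N} (hx : x ∉ Ω) : rep ι u x = 0 :=
  indicator_of_notMem hx _

lemma integrable_rep (u : D0 hs0 hs1 hp Ω) : Integrable (rep ι u) := by
  rw [rep, integrable_indicator_iff Ω.isOpen.measurableSet]
  exact L1.integrable_coeFn (ι u)

lemma rep_ae_restrict (u : D0 hs0 hs1 hp Ω) :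
    rep ι u =ᵐ[(volume : Measure (Euc N)).restrict Ω] ι u :=
  indicator_ae_eq_restrict Ω.isOpen.measurableSet

lemma setIntegral_rep (u : D0 hs0 hs1 hp Ω) : ∫ x in Ω, rep ι u x = ∫ x, rep ι u x :=
  setIntegral_eq_integral_of_forall_compl_eq_zero fun _ hx => rep_eq_zero u hx

lemma rep_coe (hι : IsCompactEmbedding ι) (φ : GagliardoTest hs0 hs1 hp Ω) :
    rep ι (φ : D0 hs0 hs1 hp Ω) =ᵐ[volume] φ.toFun := by
  have h := (ae_restrict_iff' Ω.isOpen.measurableSet).1 (hι.extends_inclusion φ)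
  filter_upwards [h] with x hx
  by_cases hxΩ : x ∈ (Ω : Set (Euc N))
  · rw [rep, indicator_of_mem hxΩ, hx hxΩ]
  · rw [rep_eq_zero _ hxΩ, φ.toFun_eq_zero hxΩ]

lemma continuous_integral_rep :
    Continuous fun u : D0 hs0 hs1 hp Ω => ∫ x, rep ι u x := by
  have h : (fun u : D0 hs0 hs1 hp Ω => ∫ x, rep ι u x) = fun u => ∫ x in Ω, ι u x := by
    funext u
    rw [← setIntegral_rep]
    exact integral_congr_ae (rep_ae_restrict u)
  rw [h]
  exact continuous_integral.comp ι.continuous |>.congr fun u => by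
    simp

/-- Every element of the completion is a limit of test functions which converge almost everywhere
to the function that it represents. -/
lemma exists_seq_tendsto_ae (hι : IsCompactEmbedding ι) (u : D0 hs0 hs1 hp Ω) :
    ∃ φ : ℕ → GagliardoTest hs0 hs1 hp Ω,
      Tendsto (fun n => (φ n : D0 hs0 hs1 hp Ω)) atTop (𝓝 u) ∧
      ∀ᵐ x, Tendsto (fun n => (φ n).toFun x) atTop (𝓝 (rep ι u x)) := by
  obtain ⟨v, hv, hvu⟩ := mem_closure_iff_seq_limit.1
    (UniformSpace.Completion.denseRange_coe (α := GagliardoTest hs0 hs1 hp Ω) u)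
  choose φ hφ using hv
  have hφu : Tendsto (fun n => (φ n : D0 hs0 hs1 hp Ω)) atTop (𝓝 u) := by simpa [hφ] using hvu
  obtain ⟨k, hk, hae⟩ :=
    (tendstoInMeasure_of_tendsto_Lp ((ι.continuous.tendsto u).comp hφu)).exists_seq_tendsto_ae
  refine ⟨fun n => φ (k n), hφu.comp hk.tendsto_atTop, ?_⟩
  filter_upwards [(ae_restrict_iff' Ω.isOpen.measurableSet).1 hae,
    ae_all_iff.2 fun n => rep_coe hι (φ n)] with x hx hrep
  by_cases hxΩ : x ∈ (Ω : Set (Euc N))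
  · have := hx hxΩ
    rw [rep, indicator_of_mem hxΩ]
    refine this.congr fun n => ?_
    rw [← hrep, rep, indicator_of_mem hxΩ]
    rfl
  · simp only [rep_eq_zero u hxΩ, GagliardoTest.toFun_eq_zero _ hxΩ]
    exact tendsto_const_nhds

/-- The energy of a difference is controlled by the distance in the completion, by Fatou's lemma
along a sequence of test functions converging to `u`. -/
lemma gagliardo_sub_rep_le (hι : IsCompactEmbedding ι) (φ : GagliardoTest hs0 hs1 hp Ω)
    (u : D0 hs0 hs1 hp Ω) :
    gagliardo s p (φ.toFun - rep ι u) ≤ ENNReal.ofReal (‖(φ : D0 hs0 hs1 hp Ω) - u‖ ^ p) := by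
  have hp0 : 0 < p := by linarith
  obtain ⟨ψ, hψ, hae⟩ := exists_seq_tendsto_ae hι u
  refine gagliardo_le_of_tendsto hp0 (u := fun n => (φ - ψ n).toFun)
    (fun n => GagliardoTest.measurable_toFun _) ?_
    (a := fun n => ENNReal.ofReal (‖(φ : D0 hs0 hs1 hp Ω) - ψ n‖ ^ p)) ?_ ?_
  · filter_upwards [hae] with x hx
    exact hx.const_sub (φ.toFun x)
  · exact ENNReal.tendsto_ofReal (((hψ.const_sub _).norm).rpow_const (Or.inr hp0.le))
  · refine Eventually.of_forall fun n => ?_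
    rw [GagliardoTest.gagliardo_eq_norm, ← UniformSpace.Completion.coe_sub,
      UniformSpace.Completion.norm_coe]

/-- The norm of the completion is the Gagliardo seminorm of the represented function. -/
lemma gagliardo_rep (hι : IsCompactEmbedding ι) (u : D0 hs0 hs1 hp Ω) :
    gagliardo s p (rep ι u) = ENNReal.ofReal (‖u‖ ^ p) := by
  have hp0 : 0 < p := by linarith
  have hz : (0 : GagliardoTest hs0 hs1 hp Ω).toFun = 0 := rfl
  apply le_antisymm
  · have := gagliardo_sub_rep_le hι 0 u
    rwa [gagliardo_sub_comm, hz, sub_zero, UniformSpace.Completion.coe_zero, zero_sub, norm_neg]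
      at this
  obtain ⟨φ, hφ, -⟩ := exists_seq_tendsto_ae hι u
  have hroot : ∀ r : ℝ, 0 ≤ r → ENNReal.ofReal (r ^ p) ^ (1 / p) = ENNReal.ofReal r :=
      fun r hr => by
    rw [ENNReal.ofReal_rpow_of_nonneg (by positivity) (by positivity), one_div,
      Real.rpow_rpow_inv hr hp0.ne']
  have h1 : ∀ n, ENNReal.ofReal ‖(φ n : D0 hs0 hs1 hp Ω)‖ ≤
      ENNReal.ofReal ‖(φ n : D0 hs0 hs1 hp Ω) - u‖ + gagliardo s p (rep ι u) ^ (1 / p) :=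
      fun n => by
    rw [← hroot _ (norm_nonneg _), ← hroot _ (norm_nonneg _), UniformSpace.Completion.norm_coe,
      ← GagliardoTest.gagliardo_eq_norm]
    calc gagliardo s p (φ n).toFun ^ (1 / p)
        = gagliardo s p (((φ n).toFun - rep ι u) + rep ι u) ^ (1 / p) := by rw [sub_add_cancel]
      _ ≤ gagliardo s p ((φ n).toFun - rep ι u) ^ (1 / p) + gagliardo s p (rep ι u) ^ (1 / p) :=
        gagliardo_add_le hp ((φ n).measurable_toFun.sub (measurable_rep u)) (measurable_rep u)
      _ ≤ _ := by gcongr; exact gagliardo_sub_rep_le hι _ _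
  have h2 : ENNReal.ofReal ‖u‖ ≤ gagliardo s p (rep ι u) ^ (1 / p) := by
    have hl := ENNReal.tendsto_ofReal hφ.norm
    have hr := (ENNReal.tendsto_ofReal (hφ.sub_const u).norm).add_const
      (gagliardo s p (rep ι u) ^ (1 / p))
    simpa using le_of_tendsto_of_tendsto' hl hr h1
  rw [← ENNReal.ofReal_rpow_of_nonneg (norm_nonneg _) hp0.le]
  calc ENNReal.ofReal ‖u‖ ^ p ≤ (gagliardo s p (rep ι u) ^ (1 / p)) ^ p := by gcongr
    _ = gagliardo s p (rep ι u) := by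
      rw [← ENNReal.rpow_mul, one_div_mul_cancel hp0.ne', ENNReal.rpow_one]

end Rep

end Energy

/-! ### Mollification -/

section Minimality

/-- Jensen's inequality for a power and a probability measure. -/
lemma rpow_lintegral_le_lintegral_rpow {α : Type*} [MeasurableSpace α] {μ : Measure α}
    [IsProbabilityMeasure μ] {p : ℝ} (hp : 1 < p) {g : α → ℝ≥0∞} (hg : Measurable g) :
    (∫⁻ a, g a ∂μ) ^ p ≤ ∫⁻ a, g a ^ p ∂μ := by
  have hp0 : 0 < p := by linarith
  have h := ENNReal.lintegral_mul_le_Lp_mul_Lq μ (Real.HolderConjugate.conjExponent hp)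
    hg.aemeasurable (aemeasurable_const (b := (1 : ℝ≥0∞)))
  simp only [Pi.mul_apply, mul_one, ENNReal.one_rpow, lintegral_const, measure_univ] at h
  calc (∫⁻ a, g a ∂μ) ^ p ≤ ((∫⁻ a, g a ^ p ∂μ) ^ (1 / p)) ^ p := by gcongr
    _ = _ := by rw [← ENNReal.rpow_mul, one_div_mul_cancel hp0.ne', ENNReal.rpow_one]

variable {N : ℕ} {s p : ℝ}

/-- Averaging over translations does not increase the Gagliardo energy, which is convex and
invariant under translations. -/
lemma gagliardo_convolution_le (hp : 1 < p) {ρ f : Euc N → ℝ} (hρ : Continuous ρ)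
    (hρc : HasCompactSupport ρ) (hρ0 : ∀ x, 0 ≤ ρ x) (hρ1 : ∫ x, ρ x = 1) (hfm : Measurable f)
    (hf : LocallyIntegrable f) :
    gagliardo s p (convolution ρ f (ContinuousLinearMap.lsmul ℝ ℝ) volume) ≤ gagliardo s p f := by
  have hp0 : 0 < p := by linarith
  set μ : Measure (Euc N) := volume.withDensity fun t => ENNReal.ofReal (ρ t) with hμ
  have hρm : Measurable fun t => ENNReal.ofReal (ρ t) := hρ.measurable.ennreal_ofReal
  have hρi : Integrable ρ := hρ.integrable_of_hasCompactSupport hρc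
  have : IsProbabilityMeasure μ := ⟨by
    rw [hμ, withDensity_apply _ MeasurableSet.univ, Measure.restrict_univ,
      ← ofReal_integral_eq_lintegral_ofReal hρi (ae_of_all _ hρ0), hρ1, ENNReal.ofReal_one]⟩
  have hex := hρc.convolutionExists_left (ContinuousLinearMap.lsmul ℝ ℝ) hρ hf
  have hpt : ∀ x y, ‖convolution ρ f (ContinuousLinearMap.lsmul ℝ ℝ) volume x -
      convolution ρ f (ContinuousLinearMap.lsmul ℝ ℝ) volume y‖ₑ ^ p ≤
        ∫⁻ t, ‖f (x - t) - f (y - t)‖ₑ ^ p ∂μ := by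
    intro x y
    have hd : Measurable fun t => ‖f (x - t) - f (y - t)‖ₑ :=
      ((hfm.comp (measurable_id.const_sub x)).sub (hfm.comp (measurable_id.const_sub y))).enorm
    refine le_trans ?_ (rpow_lintegral_le_lintegral_rpow hp hd)
    gcongr
    rw [hμ, lintegral_withDensity_eq_lintegral_mul _ hρm hd]
    simp only [convolution_def]
    rw [← integral_sub (hex x) (hex y)]
    refine (enorm_integral_le_lintegral_enorm _).trans (lintegral_mono fun t => le_of_eq ?_)
    simp only [ContinuousLinearMap.lsmul_apply, smul_eq_mul, Pi.mul_apply]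
    rw [← mul_sub, enorm_mul, Real.enorm_of_nonneg (hρ0 t)]
  have : (volume : Measure (Euc N × Euc N)).IsAddLeftInvariant := by
    rw [Measure.volume_eq_prod]
    infer_instance
  have hjoint : Measurable fun q : (Euc N × Euc N) × Euc N =>
      ‖f (q.1.1 - q.2) - f (q.1.2 - q.2)‖ₑ ^ p / ‖q.1.1 - q.1.2‖ₑ ^ ((N : ℝ) + s * p) := by
    have h1 : Measurable fun q : (Euc N × Euc N) × Euc N => f (q.1.1 - q.2) :=
      hfm.comp (by fun_prop)
    have h2 : Measurable fun q : (Euc N × Euc N) × Euc N => f (q.1.2 - q.2) :=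
      hfm.comp (by fun_prop)
    exact ((h1.sub h2).enorm.pow_const p).div (by fun_prop)
  calc gagliardo s p (convolution ρ f (ContinuousLinearMap.lsmul ℝ ℝ) volume)
      ≤ ∫⁻ z : Euc N × Euc N, ∫⁻ t, ‖f (z.1 - t) - f (z.2 - t)‖ₑ ^ p /
          ‖z.1 - z.2‖ₑ ^ ((N : ℝ) + s * p) ∂μ := by
        refine lintegral_mono fun z => ?_
        simp only [div_eq_mul_inv]
        rw [lintegral_mul_const]
        · gcongr
          exact hpt _ _
        · exact ((hfm.comp (measurable_id.const_sub z.1)).sub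
            (hfm.comp (measurable_id.const_sub z.2))).enorm.pow_const p
    _ = ∫⁻ t, (∫⁻ z : Euc N × Euc N, ‖f (z.1 - t) - f (z.2 - t)‖ₑ ^ p /
          ‖z.1 - z.2‖ₑ ^ ((N : ℝ) + s * p)) ∂μ := lintegral_lintegral_swap hjoint.aemeasurable
    _ = ∫⁻ _, gagliardo s p f ∂μ := by
        refine lintegral_congr fun t => ?_
        rw [gagliardo, ← lintegral_sub_right_eq_self (fun z : Euc N × Euc N =>
          ‖f z.1 - f z.2‖ₑ ^ p / ‖z.1 - z.2‖ₑ ^ ((N : ℝ) + s * p)) (t, t)]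
        simp
    _ = gagliardo s p f := by simp

section Torsion

variable {hs0 : 0 < s} {hs1 : s < 1} {hp : 1 < p} {Ω : Opens (Euc N)}
  {ι : D0 hs0 hs1 hp Ω →L[ℝ] Lp ℝ 1 ((volume : Measure (Euc N)).restrict Ω)}
  {w : D0 hs0 hs1 hp Ω}

/-- The test function given by a smooth function with compact support in `Ω`. -/
def mkTest (hs0 : 0 < s) (hs1 : s < 1) (hp : 1 < p) {Ω : Opens (Euc N)} (f : Euc N → ℝ)
    (h1 : ContDiff ℝ (⊤ : ℕ∞) f) (h2 : HasCompactSupport f) (h3 : tsupport f ⊆ Ω) :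
    GagliardoTest hs0 hs1 hp Ω :=
  TestFunction.mk f h1 h2 h3

lemma toFun_mkTest {f : Euc N → ℝ} (h1 : ContDiff ℝ (⊤ : ℕ∞) f) (h2 : HasCompactSupport f)
    (h3 : tsupport f ⊆ Ω) : (mkTest hs0 hs1 hp f h1 h2 h3).toFun = f := rfl

/-- An integrable function with compact support in `Ω` can be mollified to a test function with the
same integral and no more energy. -/
lemma exists_test_of_integrable (hs0 : 0 < s) (hs1 : s < 1) (hp : 1 < p) {Ω : Opens (Euc N)}
    {f : Euc N → ℝ} (hfm : Measurable f) (hf : Integrable f)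
    {K : Set (Euc N)} (hK : IsCompact K) (hKΩ : K ⊆ Ω) (hfK : ∀ x ∉ K, f x = 0) :
    ∃ φ : GagliardoTest hs0 hs1 hp Ω,
      gagliardo s p φ.toFun ≤ gagliardo s p f ∧ ∫ x, φ.toFun x = ∫ x, f x := by
  obtain ⟨δ, hδ, hsub⟩ := hK.exists_cthickening_subset_open Ω.isOpen hKΩ
  let b : ContDiffBump (0 : Euc N) := ⟨δ / 2, δ, by linarith, by linarith⟩
  set ρ : Euc N → ℝ := b.normed volume
  have hρ : ContDiff ℝ (⊤ : ℕ∞) ρ := b.contDiff_normed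
  have hρc : HasCompactSupport ρ := b.hasCompactSupport_normed
  have hsupp : Function.support (convolution ρ f (ContinuousLinearMap.lsmul ℝ ℝ) volume) ⊆
      Metric.cthickening δ K := by
    refine (support_convolution_subset _).trans ?_
    rintro _ ⟨a, ha, c, hc, rfl⟩
    have ha' : a ∈ Metric.ball (0 : Euc N) δ := by
      have : Function.support ρ = Metric.ball (0 : Euc N) b.rOut := b.support_normed_eq
      rwa [this] at ha
    have hc' : c ∈ K := by
      by_contra h
      exact hc (hfK c h)
    refine Metric.mem_cthickening_of_dist_le _ c δ K hc' ?_
    simpa [dist_eq_norm] using (mem_ball_zero_iff.1 ha').le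
  have hts : tsupport (convolution ρ f (ContinuousLinearMap.lsmul ℝ ℝ) volume) ⊆
      Metric.cthickening δ K := closure_minimal hsupp Metric.isClosed_cthickening
  have hcs : HasCompactSupport (convolution ρ f (ContinuousLinearMap.lsmul ℝ ℝ) volume) :=
    hK.cthickening.of_isClosed_subset (isClosed_tsupport _) hts
  refine ⟨mkTest hs0 hs1 hp _ (hρc.contDiff_convolution_left _ hρ hf.locallyIntegrable)
    hcs (hts.trans hsub), ?_, ?_⟩
  · rw [toFun_mkTest]
    exact gagliardo_convolution_le hp hρ.continuous hρc (fun x => b.nonneg_normed x)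
      b.integral_normed hfm hf.locallyIntegrable
  · rw [toFun_mkTest, integral_convolution _ (hρ.continuous.integrable_of_hasCompactSupport hρc) hf]
    have h1 : ∫ x, ρ x = 1 := b.integral_normed
    simp [h1]

/-! ### The torsion function -/

/-- The torsion function also minimizes among integrable functions with compact support in `Ω`. -/
lemma IsTorsionFunction.le_of_integrable (hι : IsCompactEmbedding ι) (hw : IsTorsionFunction ι w)
    {f : Euc N → ℝ} (hfm : Measurable f) (hf : Integrable f) (hfg : gagliardo s p f ≠ ∞)
    {K : Set (Euc N)} (hK : IsCompact K) (hKΩ : K ⊆ Ω) (hfK : ∀ x ∉ K, f x = 0) :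
    1 / p * ‖w‖ ^ p - ∫ x, rep ι w x ≤ 1 / p * (gagliardo s p f).toReal - ∫ x, f x := by
  have hp0 : 0 < p := by linarith
  obtain ⟨φ, hφ, hint⟩ := exists_test_of_integrable hs0 hs1 hp hfm hf hK hKΩ hfK
  have h := hw φ
  rw [setIntegral_rep, setIntegral_rep, integral_congr_ae (rep_coe hι φ), hint,
    UniformSpace.Completion.norm_coe] at h
  refine h.trans ?_
  gcongr
  rw [φ.gagliardo_eq_norm] at hφ
  exact (ENNReal.ofReal_le_iff_le_toReal hfg).1 hφ

/-- The torsion function is nonnegative: otherwise its absolute value would have a larger integral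
and no more energy. -/
lemma IsTorsionFunction.nonneg (hι : IsCompactEmbedding ι) (hw : IsTorsionFunction ι w) :
    ∀ᵐ x, 0 ≤ rep ι w x := by
  have hp0 : 0 < p := by linarith
  obtain ⟨φ, hφ, -⟩ := exists_seq_tendsto_ae hι w
  have h1 : ∀ n, 1 / p * ‖w‖ ^ p - ∫ x, rep ι w x ≤
      1 / p * ‖(φ n : D0 hs0 hs1 hp Ω)‖ ^ p - ∫ x, |rep ι (φ n : D0 hs0 hs1 hp Ω) x| := fun n => by
    have hle : gagliardo s p (fun x => |(φ n).toFun x|) ≤ gagliardo s p (φ n).toFun :=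
      gagliardo_mono hp0 fun x y => abs_abs_sub_abs_le_abs_sub _ _
    have h := hw.le_of_integrable hι (f := fun x => |(φ n).toFun x|)
      (measurable_norm.comp (φ n).measurable_toFun) (φ n).integrable_toFun.abs
      (ne_top_of_le_ne_top (φ n).gagliardo_ne_top hle)
      (φ n).hasCompactSupport_toFun (φ n).tsupport_toFun_subset
      (fun x hx => by simp [image_eq_zero_of_notMem_tsupport hx])
    have he : ∫ x, |rep ι (φ n : D0 hs0 hs1 hp Ω) x| = ∫ x, |(φ n).toFun x| :=
      integral_congr_ae ((rep_coe hι (φ n)).fun_comp abs)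
    rw [he, UniformSpace.Completion.norm_coe]
    refine h.trans ?_
    gcongr
    refine ENNReal.toReal_le_of_le_ofReal (by positivity) ?_
    rwa [← GagliardoTest.gagliardo_eq_norm]
  have hcont : Continuous fun u : D0 hs0 hs1 hp Ω => ∫ x, |rep ι u x| := by
    have : (fun u : D0 hs0 hs1 hp Ω => ∫ x, |rep ι u x|) = fun u => ‖ι u‖ := by
      funext u
      rw [L1.norm_eq_integral_norm]
      refine Eq.trans ?_ (integral_congr_ae ((rep_ae_restrict u).fun_comp norm))
      exact (setIntegral_eq_integral_of_forall_compl_eq_zero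
        fun x hx => by simp [rep_eq_zero u hx]).symm
    rw [this]
    exact ι.continuous.norm
  have h2 := ge_of_tendsto'
    (((hφ.norm.rpow_const (Or.inr hp0.le)).const_mul (1 / p)).sub ((hcont.tendsto w).comp hφ)) h1
  have hi := integrable_rep (ι := ι) w
  have h3 : ∫ x, (|rep ι w x| - rep ι w x) ≤ 0 := by
    rw [integral_sub hi.abs hi]
    linarith
  have h4 : 0 ≤ fun x => |rep ι w x| - rep ι w x := fun x => sub_nonneg.2 (le_abs_self _)
  have h5 := (integral_eq_zero_iff_of_nonneg h4 (hi.abs.sub hi)).1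
    (le_antisymm h3 (integral_nonneg h4))
  filter_upwards [h5] with x hx
  have : |rep ι w x| - rep ι w x = 0 := hx
  rw [← sub_eq_zero.1 this]
  exact abs_nonneg _

/-- The torsion function minimizes the energy among its own compactly supported perturbations. -/
lemma IsTorsionFunction.le_add (hι : IsCompactEmbedding ι) (hw : IsTorsionFunction ι w)
    {ψ : Euc N → ℝ} (hψm : Measurable ψ) (hψ : Integrable ψ) (hψg : gagliardo s p ψ ≠ ∞)
    {K : Set (Euc N)} (hK : IsCompact K) (hKΩ : K ⊆ Ω) (hψK : ∀ x ∉ K, ψ x = 0) :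
    1 / p * (gagliardo s p (rep ι w)).toReal ≤
      1 / p * (gagliardo s p (rep ι w + ψ)).toReal - ∫ x, ψ x := by
  have hp0 : 0 < p := by linarith
  have hpow : ∀ a : ℝ≥0∞, (a ^ (1 / p)) ^ p = a := fun a => by
    rw [← ENNReal.rpow_mul, one_div_mul_cancel hp0.ne', ENNReal.rpow_one]
  have hfin : gagliardo s p (rep ι w + ψ) ≠ ∞ :=
    gagliardo_add_ne_top hp (measurable_rep w) hψm (gagliardo_rep hι w ▸ ENNReal.ofReal_ne_top) hψg
  obtain ⟨φ, hφ, -⟩ := exists_seq_tendsto_ae hι w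
  set r : ℕ → ℝ := fun n => ‖(φ n : D0 hs0 hs1 hp Ω) - w‖
  set g : ℝ := (gagliardo s p (rep ι w + ψ)).toReal
  have hr : Tendsto r atTop (𝓝 0) := by
    simpa using (hφ.sub_const w).norm
  have h1 : ∀ n, gagliardo s p ((φ n).toFun + ψ) ≤ ENNReal.ofReal ((r n + g ^ (1 / p)) ^ p) :=
    fun n => by
    rw [← ENNReal.ofReal_rpow_of_nonneg (by positivity) hp0.le, ← hpow (gagliardo s p _)]
    gcongr
    have e : (φ n).toFun + ψ = ((φ n).toFun - rep ι w) + (rep ι w + ψ) := by abel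
    rw [e]
    refine (gagliardo_add_le hp ((φ n).measurable_toFun.sub (measurable_rep w))
      ((measurable_rep w).add hψm)).trans ?_
    rw [ENNReal.ofReal_add (by positivity) (by positivity)]
    gcongr
    · refine (ENNReal.rpow_le_rpow (gagliardo_sub_rep_le hι (φ n) w) (by positivity)).trans_eq ?_
      rw [ENNReal.ofReal_rpow_of_nonneg (by positivity) (by positivity), one_div,
        Real.rpow_rpow_inv (norm_nonneg _) hp0.ne']
    · rw [← ENNReal.ofReal_rpow_of_nonneg ENNReal.toReal_nonneg (by positivity),
        ENNReal.ofReal_toReal hfin]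
  have h2 : ∀ n, 1 / p * ‖w‖ ^ p - ∫ x, rep ι w x ≤ 1 / p * (r n + g ^ (1 / p)) ^ p -
      ((∫ x, rep ι (φ n : D0 hs0 hs1 hp Ω) x) + ∫ x, ψ x) := fun n => by
    have h := hw.le_of_integrable hι (f := (φ n).toFun + ψ) ((φ n).measurable_toFun.add hψm)
      ((φ n).integrable_toFun.add hψ) (ne_top_of_le_ne_top ENNReal.ofReal_ne_top (h1 n))
      ((φ n).hasCompactSupport_toFun.isCompact.union hK)
      (union_subset (φ n).tsupport_toFun_subset hKΩ)
      (fun x hx => by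
        rw [mem_union, not_or] at hx
        simp [image_eq_zero_of_notMem_tsupport hx.1, hψK x hx.2])
    rw [integral_congr_ae (rep_coe hι (φ n))]
    simp only [Pi.add_apply] at h
    rw [integral_add (φ n).integrable_toFun hψ] at h
    refine h.trans ?_
    gcongr
    exact ENNReal.toReal_le_of_le_ofReal (by positivity) (h1 n)
  have h3 := ge_of_tendsto' ((((hr.add_const (g ^ (1 / p))).rpow_const
    (Or.inr hp0.le)).const_mul (1 / p)).sub
      ((((continuous_integral_rep (ι := ι)).tendsto w).comp hφ).add_const (∫ x, ψ x))) h2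
  rw [zero_add, one_div, Real.rpow_inv_rpow ENNReal.toReal_nonneg hp0.ne'] at h3
  rw [gagliardo_rep hι w, ENNReal.toReal_ofReal (by positivity), one_div]
  linarith

end Torsion

end Minimality

/-! ### The Euler–Lagrange equation -/

section EulerLagrange

/-- First-order condition for the minimality of `f` along the line `f + t g`, for the `p`-th power
of the `L^p` norm minus a linear term. -/
lemma integral_eq_of_forall_le {α : Type*} [MeasurableSpace α] {μ : Measure α} {p c : ℝ}
    (hp : 1 < p) {f g : α → ℝ} (hf : MemLp f (ENNReal.ofReal p) μ)
    (hg : MemLp g (ENNReal.ofReal p) μ)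
    (h : ∀ t : ℝ, 1 / p * ∫ a, |f a| ^ p ∂μ ≤ 1 / p * ∫ a, |f a + t * g a| ^ p ∂μ - t * c) :
    Integrable (fun a => |f a| ^ (p - 2) * f a * g a) μ ∧
      ∫ a, |f a| ^ (p - 2) * f a * g a ∂μ = c := by
  have hp0 : 0 < p := by linarith
  have hpE : ENNReal.ofReal p ≠ 0 := by simpa using hp0
  have hint : ∀ {k : α → ℝ}, MemLp k (ENNReal.ofReal p) μ → Integrable (fun a => |k a| ^ p) μ :=
    fun hk => by
      have := hk.integrable_norm_rpow hpE ENNReal.ofReal_ne_top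
      simpa [ENNReal.toReal_ofReal hp0.le] using this
  have hd := hasDerivAt_integral_of_dominated_loc_of_deriv_le (μ := μ) (𝕜 := ℝ) (x₀ := 0)
    (s := Metric.ball 0 1)
    (F := fun t a => |f a + t * g a| ^ p)
    (F' := fun t a => p * |f a + t * g a| ^ (p - 2) * (f a + t * g a) * g a)
    (bound := fun a => p * |(|f a| + |g a|)| ^ p) (Metric.ball_mem_nhds 0 one_pos)
    (Eventually.of_forall fun t => ?_) ?_ ?_ (ae_of_all _ fun a t ht => ?_) ?_
    (ae_of_all _ fun a t ht => ?_)
  · simp only [zero_mul, add_zero] at hd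
    have e : (fun a => p * |f a| ^ (p - 2) * f a * g a) =
        fun a => p * (|f a| ^ (p - 2) * f a * g a) := by funext a; ring
    rw [e] at hd
    refine ⟨(integrable_const_mul_iff (isUnit_iff_ne_zero.2 hp0.ne') _).1 hd.1, ?_⟩
    have hmin : IsLocalMin (fun t : ℝ => 1 / p * ∫ a, |f a + t * g a| ^ p ∂μ - t * c) 0 :=
      Eventually.of_forall fun t => by simpa using h t
    have hd' := (hd.2.const_mul (1 / p)).sub ((hasDerivAt_id (0 : ℝ)).mul_const c)
    have h0 := hmin.hasDerivAt_eq_zero hd'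
    rw [integral_const_mul, ← mul_assoc, one_div_mul_cancel hp0.ne'] at h0
    linarith
  · have := hf.1.add (hg.1.const_mul t)
    exact (this.aemeasurable.norm.pow_const p).aestronglyMeasurable
  · simpa using hint hf
  · simp only [zero_mul, add_zero]
    have h1 := hf.1.aemeasurable
    have h2 := hg.1.aemeasurable
    exact ((((h1.norm.pow_const (p - 2)).const_mul p).mul h1).mul h2).aestronglyMeasurable
  · have ht1 : |t| ≤ 1 := by simpa using (mem_ball_zero_iff.1 ht).le
    set k := f a + t * g a
    have hk : |k| ≤ |f a| + |g a| := by
      refine (abs_add_le _ _).trans ?_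
      rw [abs_mul]
      nlinarith [abs_nonneg (g a)]
    have hkk : |k| ^ (p - 2) * |k| ≤ (|f a| + |g a|) ^ (p - 1) := by
      rcases eq_or_ne k 0 with h0 | h0
      · rw [h0, abs_zero, mul_zero]; positivity
      · rw [← Real.rpow_add_one (abs_ne_zero.2 h0), show p - 2 + 1 = p - 1 by ring]
        gcongr
    rw [Real.norm_eq_abs, abs_mul, abs_mul, abs_mul, abs_of_pos hp0,
      abs_of_nonneg (Real.rpow_nonneg (abs_nonneg k) _), abs_of_nonneg (by positivity :
        0 ≤ |f a| + |g a|), mul_assoc p, mul_assoc p]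
    gcongr
    calc |k| ^ (p - 2) * |k| * |g a| ≤ (|f a| + |g a|) ^ (p - 1) * (|f a| + |g a|) := by
          gcongr
          exact le_add_of_nonneg_left (abs_nonneg _)
      _ = (|f a| + |g a|) ^ p := by
          rw [← Real.rpow_add_one' (by positivity) (by simpa using hp0.ne'), sub_add_cancel]
  · exact (hint (hf.norm.add hg.norm)).const_mul p
  · have h1 : HasDerivAt (fun t => f a + t * g a) (g a) t := by
      simpa using ((hasDerivAt_id t).mul_const (g a)).const_add (f a)
    exact (hasDerivAt_abs_rpow (f a + t * g a) hp).comp t h1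

variable {N : ℕ} {s p : ℝ}

lemma memLp_diff (hp : 1 < p) {u : Euc N → ℝ} (hu : Measurable u) (hg : gagliardo s p u ≠ ∞) :
    MemLp (diff u) (ENNReal.ofReal p) (kernelMeasure N (N + s * p)) := by
  have hp0 : 0 < p := by linarith
  refine ⟨(measurable_diff hu).aestronglyMeasurable, ?_⟩
  rw [eLpNorm_lt_top_iff_lintegral_rpow_enorm_lt_top (by simpa using hp0) ENNReal.ofReal_ne_top,
    ENNReal.toReal_ofReal hp0.le, ← gagliardo_eq_lintegral hu]
  exact hg.lt_top

lemma toReal_gagliardo (hp : 1 < p) {u : Euc N → ℝ} (hu : Measurable u) :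
    (gagliardo s p u).toReal = ∫ z, |diff u z| ^ p ∂(kernelMeasure N (N + s * p)) := by
  have hp0 : 0 < p := by linarith
  rw [integral_eq_lintegral_of_nonneg_ae (f := fun z => |diff u z| ^ p)
    (ae_of_all _ fun z => by positivity)
    ((measurable_diff hu).norm.pow_const p).aestronglyMeasurable, gagliardo_eq_lintegral hu]
  congr 1
  refine lintegral_congr fun z => ?_
  rw [← ENNReal.ofReal_rpow_of_nonneg (abs_nonneg _) hp0.le, ← Real.norm_eq_abs, ofReal_norm]

variable {hs0 : 0 < s} {hs1 : s < 1} {hp : 1 < p} {Ω : Opens (Euc N)}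
  {ι : D0 hs0 hs1 hp Ω →L[ℝ] Lp ℝ 1 ((volume : Measure (Euc N)).restrict Ω)}
  {w : D0 hs0 hs1 hp Ω}

/-- The weak form of `(-Δ_p)^s w = 1`, tested against a compactly supported function. -/
lemma IsTorsionFunction.euler_lagrange (hι : IsCompactEmbedding ι) (hw : IsTorsionFunction ι w)
    {W : Euc N → ℝ} (hWm : Measurable W) (hW : rep ι w =ᵐ[volume] W)
    {ψ : Euc N → ℝ} (hψm : Measurable ψ) (hψ : Integrable ψ) (hψg : gagliardo s p ψ ≠ ∞)
    {K : Set (Euc N)} (hK : IsCompact K) (hKΩ : K ⊆ Ω) (hψK : ∀ x ∉ K, ψ x = 0) :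
    Integrable (fun z => |diff W z| ^ (p - 2) * diff W z * diff ψ z)
        (kernelMeasure N (N + s * p)) ∧
      ∫ z, |diff W z| ^ (p - 2) * diff W z * diff ψ z ∂(kernelMeasure N (N + s * p)) =
        ∫ x, ψ x := by
  have hWg : gagliardo s p W ≠ ∞ := by
    rw [← gagliardo_congr_ae hW, gagliardo_rep hι w]
    exact ENNReal.ofReal_ne_top
  refine integral_eq_of_forall_le hp (memLp_diff hp hWm hWg) (memLp_diff hp hψm hψg) fun t => ?_
  have htm : Measurable (t • ψ) := hψm.const_smul t
  have h := hw.le_add hι (ψ := t • ψ) htm (hψ.smul t)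
    (by
      rw [gagliardo_smul hp t ψ hψm]
      exact ENNReal.mul_ne_top (ENNReal.rpow_ne_top_of_nonneg (by linarith) enorm_ne_top) hψg)
    hK hKΩ (fun x hx => by simp [hψK x hx])
  rw [gagliardo_congr_ae hW, gagliardo_congr_ae (hW.add (ae_eq_refl (t • ψ))),
    toReal_gagliardo hp hWm, toReal_gagliardo hp (hWm.add htm)] at h
  have e : ∀ z, diff (W + t • ψ) z = diff W z + t * diff ψ z := fun z => by
    simp only [diff, Pi.add_apply, Pi.smul_apply, smul_eq_mul]; ring
  have e2 : ∫ x, (t • ψ) x = t * ∫ x, ψ x := by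
    simp only [Pi.smul_apply, smul_eq_mul]
    exact integral_const_mul _ _
  rw [e2] at h
  simpa only [e] using h

end EulerLagrange

/-! ### Picone's inequality with a remainder -/

section Picone

lemma rpow_le_of_convex {p m A B : ℝ} (hp : 1 < p) (hm0 : 0 < m) (hm1 : m < 1) (hA : 0 ≤ A)
    (hB : 0 ≤ B) : A ^ p ≤ m ^ (1 - p) * B ^ p + (1 - m) ^ (1 - p) * |A - B| ^ p := by
  have hn : 0 < 1 - m := by linarith
  have hsplit : ∀ {k X : ℝ}, 0 < k → 0 ≤ X → k * (X / k) ^ p = k ^ (1 - p) * X ^ p := by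
    intro k X hk hX
    rw [Real.div_rpow hX hk.le, Real.rpow_sub hk, Real.rpow_one]
    field_simp
  have hconv := (convexOn_rpow hp.le).2 (x := B / m) (y := |A - B| / (1 - m))
    (by simp only [mem_Ici]; positivity) (by simp only [mem_Ici]; positivity) hm0.le hn.le
    (by ring)
  simp only [smul_eq_mul] at hconv
  rw [hsplit hm0 hB, hsplit hn (abs_nonneg _), mul_div_cancel₀ _ hm0.ne',
    mul_div_cancel₀ _ hn.ne'] at hconv
  refine le_trans ?_ hconv
  gcongr
  linarith [le_abs_self (A - B)]

/-- A quantitative form of `((1 + t) / 2) ^ (1 - p) < t ^ (1 - p)`. -/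
lemma half_one_add_rpow_le {p t : ℝ} (hp : 1 < p) (ht0 : 0 < t) (ht1 : t < 1) :
    ((1 + t) / 2) ^ (1 - p) + (p - 1) / 2 * (1 - t) ≤ t ^ (1 - p) := by
  set m := (1 + t) / 2 with hm
  have hm0 : 0 < m := by positivity
  have hm1 : m ≤ 1 := by linarith
  have hx : 0 < t / m := by positivity
  have h1 : 1 + (p - 1) * (1 - t / m) ≤ (t / m) ^ (1 - p) := by
    rw [Real.rpow_def_of_pos hx]
    have h := Real.add_one_le_exp (Real.log (t / m) * (1 - p))
    have hl := Real.log_le_sub_one_of_pos hx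
    nlinarith
  have h2 : (1 - t) / 2 ≤ 1 - t / m := by
    rw [le_sub_iff_add_le, ← le_sub_iff_add_le', div_le_iff₀ hm0]
    nlinarith
  have h3 : 1 ≤ m ^ (1 - p) := Real.one_le_rpow_of_pos_of_le_one_of_nonpos hm0 hm1 (by linarith)
  have h4 : t ^ (1 - p) = m ^ (1 - p) * (t / m) ^ (1 - p) := by
    rw [← Real.mul_rpow hm0.le hx.le, mul_div_cancel₀ _ hm0.ne']
  have h5 : 1 + (p - 1) / 2 * (1 - t) ≤ (t / m) ^ (1 - p) := by nlinarith
  have h6 : 0 ≤ (p - 1) / 2 * (1 - t) := mul_nonneg (by linarith) (by linarith)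
  rw [h4]
  nlinarith

/-- The normalized form of Picone's inequality, where `t` is the ratio of the two values of the
torsion function. -/
lemma picone_normalized {p c t A B : ℝ} (hp : 1 < p) (hc0 : 0 ≤ c)
    (hc : c * (2 ^ (p - 1) + 1) ≤ (p - 1) / 2) (ht0 : 0 < t) (ht1 : t < 1) (hA : 0 ≤ A)
    (hB : 0 ≤ B) :
    (1 - t) ^ (p - 1) * (A ^ p - B ^ p * t ^ (1 - p)) + c * (1 - t) ^ p * (A ^ p + B ^ p) ≤
      2 ^ (p - 1) * (1 + c) * |A - B| ^ p := by
  have hd : 0 < 1 - t := by linarith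
  have hd1 : (1 - t) ^ p ≤ 1 := Real.rpow_le_one hd.le (by linarith) (by linarith)
  have hd0 : 0 ≤ (1 - t) ^ p := by positivity
  have hdp : (1 - t) ^ (p - 1) * (1 - t) = (1 - t) ^ p := by
    rw [← Real.rpow_add_one hd.ne', sub_add_cancel]
  set D := |A - B| ^ p
  have hD : 0 ≤ D := by positivity
  have hBp : 0 ≤ B ^ p := by positivity
  -- with the weights `(1 + t) / 2` and `(1 - t) / 2` the coefficient of `|A - B| ^ p` is a constant
  have h1 := rpow_le_of_convex (m := (1 + t) / 2) hp (by positivity) (by linarith) hA hB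
  have h2 := half_one_add_rpow_le hp ht0 ht1
  have e1 : (1 - t) ^ (p - 1) * (1 - (1 + t) / 2) ^ (1 - p) = 2 ^ (p - 1) := by
    rw [show 1 - (1 + t) / 2 = (1 - t) / 2 by ring, show 1 - p = -(p - 1) by ring,
      Real.rpow_neg (by positivity), Real.div_rpow hd.le zero_le_two, inv_div]
    field_simp
  have h3 : (1 - t) ^ (p - 1) * A ^ p ≤ (1 - t) ^ (p - 1) * t ^ (1 - p) * B ^ p -
      (p - 1) / 2 * (1 - t) ^ p * B ^ p + 2 ^ (p - 1) * D := by
    calc (1 - t) ^ (p - 1) * A ^ p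
        ≤ (1 - t) ^ (p - 1) * ((t ^ (1 - p) - (p - 1) / 2 * (1 - t)) * B ^ p +
            (1 - (1 + t) / 2) ^ (1 - p) * D) := by
          gcongr
          refine h1.trans ?_
          gcongr
          linarith
      _ = (1 - t) ^ (p - 1) * t ^ (1 - p) * B ^ p -
            (p - 1) / 2 * ((1 - t) ^ (p - 1) * (1 - t)) * B ^ p +
            (1 - t) ^ (p - 1) * (1 - (1 + t) / 2) ^ (1 - p) * D := by ring
      _ = _ := by rw [hdp, e1]
  have h4 : A ^ p ≤ 2 ^ (p - 1) * B ^ p + 2 ^ (p - 1) * D := by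
    have h := rpow_le_of_convex (m := 2⁻¹) hp (by norm_num) (by norm_num) hA hB
    have e : (2⁻¹ : ℝ) ^ (1 - p) = 2 ^ (p - 1) := by
      rw [Real.inv_rpow zero_le_two, ← Real.rpow_neg zero_le_two, neg_sub]
    rwa [show (1 : ℝ) - 2⁻¹ = 2⁻¹ by norm_num, e] at h
  have h5 : c * (1 - t) ^ p * (A ^ p + B ^ p) ≤
      (p - 1) / 2 * (1 - t) ^ p * B ^ p + 2 ^ (p - 1) * c * D := by
    calc c * (1 - t) ^ p * (A ^ p + B ^ p)
        ≤ c * (1 - t) ^ p * ((2 ^ (p - 1) * B ^ p + 2 ^ (p - 1) * D) + B ^ p) := by gcongr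
      _ = c * (2 ^ (p - 1) + 1) * ((1 - t) ^ p * B ^ p) +
            2 ^ (p - 1) * c * D * (1 - t) ^ p := by ring
      _ ≤ (p - 1) / 2 * ((1 - t) ^ p * B ^ p) + 2 ^ (p - 1) * c * D * 1 := by gcongr
      _ = _ := by ring
  linarith

/-- Picone's inequality for `|a - b| ^ (p - 2) (a - b)`, with a remainder. -/
lemma exists_picone {p : ℝ} (hp : 1 < p) : ∃ c C : ℝ, 0 < c ∧ c ≤ 1 ∧ 0 < C ∧
    ∀ {a b A B : ℝ}, 0 < a → 0 < b → 0 ≤ A → 0 ≤ B →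
      |a - b| ^ (p - 2) * (a - b) * (A ^ p / a ^ (p - 1) - B ^ p / b ^ (p - 1)) +
        c * ((|a - b| / (a + b)) ^ p * (A ^ p + B ^ p)) ≤ C * |A - B| ^ p := by
  have hp1 : 0 < p - 1 := by linarith
  set k : ℝ := 2 ^ (p - 1) + 1
  have hk : 0 < k := by positivity
  set c : ℝ := (p - 1) / (2 * k + (p - 1)) with hcdef
  have hden : 0 < 2 * k + (p - 1) := by positivity
  have hc0 : 0 < c := by positivity
  have hc : c * k ≤ (p - 1) / 2 := by
    rw [hcdef, div_mul_eq_mul_div, div_le_div_iff₀ hden two_pos]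
    nlinarith
  have main : ∀ {a b A B : ℝ}, 0 < a → 0 < b → 0 ≤ A → 0 ≤ B → b < a →
      |a - b| ^ (p - 2) * (a - b) * (A ^ p / a ^ (p - 1) - B ^ p / b ^ (p - 1)) +
        c * ((|a - b| / (a + b)) ^ p * (A ^ p + B ^ p)) ≤
          2 ^ (p - 1) * (1 + c) * |A - B| ^ p := by
    intro a b A B ha hb hA hB hab
    have hd : 0 < a - b := by linarith
    have hba : 0 < b / a := by positivity
    have h := picone_normalized hp hc0.le hc hba ((div_lt_one ha).2 hab) hA hB
    refine le_trans ?_ h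
    have e0 : 1 - b / a = (a - b) / a := by field_simp
    have e1 : |a - b| ^ (p - 2) * (a - b) = (a - b) ^ (p - 1) := by
      rw [abs_of_pos hd, ← Real.rpow_add_one hd.ne']
      congr 1
      ring
    have e2 : (a - b) ^ (p - 1) * (A ^ p / a ^ (p - 1) - B ^ p / b ^ (p - 1)) =
        (1 - b / a) ^ (p - 1) * (A ^ p - B ^ p * (b / a) ^ (1 - p)) := by
      rw [e0, show 1 - p = -(p - 1) by ring, Real.rpow_neg hba.le, Real.div_rpow hd.le ha.le,
        Real.div_rpow hb.le ha.le]
      have h1 : 0 < a ^ (p - 1) := by positivity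
      have h2 : 0 < b ^ (p - 1) := by positivity
      field_simp
    rw [e1, e2, ← mul_assoc, e0, abs_of_pos hd]
    gcongr
    linarith
  refine ⟨c, 2 ^ (p - 1) * (1 + c), hc0, ?_, by positivity, ?_⟩
  · rw [hcdef, div_le_one hden]
    linarith
  intro a b A B ha hb hA hB
  rcases lt_trichotomy b a with hab | hab | hab
  · exact main ha hb hA hB hab
  · have hp0 : p ≠ 0 := by linarith
    simp only [hab, sub_self, abs_zero, mul_zero, zero_mul, zero_div, Real.zero_rpow hp0, add_zero]
    positivity
  · have h := main hb ha hB hA hab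
    rw [abs_sub_comm b a, abs_sub_comm B A, add_comm b a, add_comm (B ^ p)] at h
    calc _ = _ := by ring
      _ ≤ _ := h

end Picone

/-! ### The inequality for test functions and a regularized torsion function -/

section Regularized

lemma abs_rpow_sub_rpow_le {p M A B : ℝ} (hp : 1 < p) (hA : A ∈ Icc 0 M) (hB : B ∈ Icc 0 M) :
    |A ^ p - B ^ p| ≤ p * M ^ (p - 1) * |A - B| := by
  have h := (convex_Icc (0 : ℝ) M).norm_image_sub_le_of_norm_hasDerivWithin_le
    (f := fun x => x ^ p) (f' := fun x => p * x ^ (p - 1)) (C := p * M ^ (p - 1))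
    (fun x _ => (Real.hasDerivAt_rpow_const (Or.inr hp.le)).hasDerivWithinAt)
    (fun x hx => by
      have := hx.1
      rw [Real.norm_of_nonneg (by positivity)]
      gcongr
      exact hx.2) hB hA
  simpa using h

lemma abs_rpow_one_sub_sub_le {p ε a b : ℝ} (hp : 1 < p) (hε : 0 < ε) (ha : ε ≤ a) (hb : ε ≤ b) :
    |a ^ (1 - p) - b ^ (1 - p)| ≤ (p - 1) * ε ^ (-p) * |a - b| := by
  have h := (convex_Ici ε).norm_image_sub_le_of_norm_hasDerivWithin_le
    (f := fun x => x ^ (1 - p)) (f' := fun x => (1 - p) * x ^ (1 - p - 1))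
    (C := (p - 1) * ε ^ (-p))
    (fun x hx => (Real.hasDerivAt_rpow_const
      (Or.inl (hε.trans_le hx).ne')).hasDerivWithinAt)
    (fun x hx => by
      have hx0 : 0 < x := hε.trans_le hx
      rw [norm_mul, Real.norm_of_nonpos (by linarith), Real.norm_of_nonneg (by positivity), neg_sub,
        show 1 - p - 1 = -p by ring]
      gcongr ?_ * ?_
      exact Real.rpow_le_rpow_of_nonpos hε hx (by linarith)) hb ha
  simpa using h

variable {N : ℕ} {s p : ℝ}

/-- The regularized Picone test function `|u| ^ p / (W + ε) ^ (p - 1)` has finite energy. -/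
lemma gagliardo_picone_ne_top (hp : 1 < p) {u W : Euc N → ℝ} (hum : Measurable u)
    (hug : gagliardo s p u ≠ ∞) {M : ℝ} (huM : ∀ x, |u x| ≤ M) (hWm : Measurable W)
    (hWg : gagliardo s p W ≠ ∞) (hW0 : ∀ x, 0 ≤ W x) {ε : ℝ} (hε : 0 < ε) :
    gagliardo s p (fun x => |u x| ^ p / (W x + ε) ^ (p - 1)) ≠ ∞ := by
  have hp0 : 0 < p := by linarith
  have hψm : Measurable fun x => |u x| ^ p / (W x + ε) ^ (p - 1) :=
    (hum.norm.pow_const p).div ((hWm.add_const ε).pow_const (p - 1))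
  have hM : 0 ≤ M := (abs_nonneg _).trans (huM 0)
  have hdom := ((memLp_diff hp hum hug).norm.const_mul (p * M ^ (p - 1) * ε ^ (1 - p))).add
    ((memLp_diff hp hWm hWg).norm.const_mul (M ^ p * ((p - 1) * ε ^ (-p))))
  have hψ := hdom.mono (measurable_diff hψm).aestronglyMeasurable (ae_of_all _ fun z => by
    set a := W z.1 + ε with ha
    set b := W z.2 + ε with hb
    have ha' : ε ≤ a := by linarith [hW0 z.1]
    have hb' : ε ≤ b := by linarith [hW0 z.2]
    have ha0 : 0 < a := by linarith
    have hb0 : 0 < b := by linarith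
    have hinv : ∀ {t : ℝ}, 0 < t → ∀ X : ℝ, X / t ^ (p - 1) = X * t ^ (1 - p) := fun ht X => by
      rw [← neg_sub p 1, Real.rpow_neg ht.le, div_eq_mul_inv]
    have e : diff (fun x => |u x| ^ p / (W x + ε) ^ (p - 1)) z =
        (|u z.1| ^ p - |u z.2| ^ p) * a ^ (1 - p) +
          |u z.2| ^ p * (a ^ (1 - p) - b ^ (1 - p)) := by
      simp only [diff, ← ha, ← hb, hinv ha0, hinv hb0]
      ring
    have h1 := abs_rpow_sub_rpow_le (M := M) hp ⟨abs_nonneg (u z.1), huM z.1⟩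
      ⟨abs_nonneg (u z.2), huM z.2⟩
    have h2 := abs_rpow_one_sub_sub_le hp hε ha' hb'
    have h3 : a ^ (1 - p) ≤ ε ^ (1 - p) :=
      Real.rpow_le_rpow_of_nonpos hε ha' (by linarith)
    have h4 : a - b = diff W z := by simp only [diff, ha, hb]; ring
    have h5 : |(|u z.1| - |u z.2|)| ≤ |diff u z| := abs_abs_sub_abs_le_abs_sub _ _
    have hp1 : 0 ≤ p - 1 := by linarith
    simp only [Pi.add_apply, Real.norm_eq_abs]
    rw [e]
    refine ((abs_add_le _ _).trans (add_le_add ?_ ?_)).trans (le_abs_self _)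
    · rw [abs_mul, abs_of_nonneg (a := a ^ (1 - p)) (by positivity)]
      calc |(|u z.1| ^ p - |u z.2| ^ p)| * a ^ (1 - p)
          ≤ p * M ^ (p - 1) * |diff u z| * ε ^ (1 - p) := by
            gcongr
            exact h1.trans (by gcongr)
        _ = _ := by ring
    · rw [abs_mul, abs_of_nonneg (a := |u z.2| ^ p) (by positivity), mul_assoc (M ^ p), ← h4]
      gcongr
      exact huM z.2)
  have := hψ.2
  rw [eLpNorm_lt_top_iff_lintegral_rpow_enorm_lt_top (by simpa using hp0) ENNReal.ofReal_ne_top,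
    ENNReal.toReal_ofReal hp0.le, ← gagliardo_eq_lintegral hψm] at this
  exact this.ne

lemma lintegral_kernelMeasure_swap (e : ℝ) {f : Euc N × Euc N → ℝ≥0∞} (hf : Measurable f) :
    ∫⁻ z, f z.swap ∂(kernelMeasure N e) = ∫⁻ z, f z ∂(kernelMeasure N e) := by
  rw [lintegral_kernelMeasure _ hf,
    lintegral_kernelMeasure _ (f := fun z => f z.swap) (hf.comp measurable_swap),
    Measure.volume_eq_prod,
    ← lintegral_prod_swap (μ := (volume : Measure (Euc N))) (ν := (volume : Measure (Euc N)))
      (fun z : Euc N × Euc N => f z / ‖z.1 - z.2‖ₑ ^ e)]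
  refine lintegral_congr fun z => ?_
  rw [Prod.fst_swap, Prod.snd_swap, ← enorm_neg (z.2 - z.1), neg_sub]

variable {hs0 : 0 < s} {hs1 : s < 1} {hp : 1 < p} {Ω : Opens (Euc N)}
  {ι : D0 hs0 hs1 hp Ω →L[ℝ] Lp ℝ 1 ((volume : Measure (Euc N)).restrict Ω)}
  {w : D0 hs0 hs1 hp Ω}

/-- The weak equation for the torsion function, tested against `|φ| ^ p / (W + ε) ^ (p - 1)` and
combined with Picone's inequality. -/
lemma IsTorsionFunction.regularized_hardy (hι : IsCompactEmbedding ι) (hw : IsTorsionFunction ι w)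
    {W : Euc N → ℝ} (hWm : Measurable W) (hW0 : ∀ x, 0 ≤ W x) (hW : rep ι w =ᵐ[volume] W)
    {c C : ℝ} (hc0 : 0 < c) (hc1 : c ≤ 1) (hC : 0 < C)
    (hpic : ∀ {a b A B : ℝ}, 0 < a → 0 < b → 0 ≤ A → 0 ≤ B →
      |a - b| ^ (p - 2) * (a - b) * (A ^ p / a ^ (p - 1) - B ^ p / b ^ (p - 1)) +
        c * ((|a - b| / (a + b)) ^ p * (A ^ p + B ^ p)) ≤ C * |A - B| ^ p)
    (φ : GagliardoTest hs0 hs1 hp Ω) {ε : ℝ} (hε : 0 < ε) :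
    ENNReal.ofReal c * ((∫⁻ x, ‖φ.toFun x‖ₑ ^ p / ENNReal.ofReal (W x + ε) ^ (p - 1)) +
      2 * ∫⁻ z : Euc N × Euc N,
        (‖W z.1 - W z.2‖ₑ / ENNReal.ofReal (W z.1 + ε + (W z.2 + ε))) ^ p * ‖φ.toFun z.1‖ₑ ^ p
          / ‖z.1 - z.2‖ₑ ^ ((N : ℝ) + s * p)) ≤
      ENNReal.ofReal C * gagliardo s p φ.toFun := by
  have hp0 : 0 < p := by linarith
  set u := φ.toFun with hu
  have hum : Measurable u := φ.measurable_toFun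
  set ν := kernelMeasure N (N + s * p) with hν
  set ψ : Euc N → ℝ := fun x => |u x| ^ p / (W x + ε) ^ (p - 1) with hψ
  have hWε : ∀ x, 0 < W x + ε := fun x => by linarith [hW0 x]
  have hψm : Measurable ψ := (hum.norm.pow_const p).div ((hWm.add_const ε).pow_const (p - 1))
  have hψ0 : ∀ x, 0 ≤ ψ x := fun x => div_nonneg (by positivity) (Real.rpow_nonneg (hWε x).le _)
  obtain ⟨M, hM⟩ := φ.contDiff_toFun.continuous.bounded_above_of_compact_support
    φ.hasCompactSupport_toFun
  have hWg : gagliardo s p W ≠ ∞ := by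
    rw [← gagliardo_congr_ae hW, gagliardo_rep hι w]
    exact ENNReal.ofReal_ne_top
  have hψg : gagliardo s p ψ ≠ ∞ :=
    gagliardo_picone_ne_top hp hum φ.gagliardo_ne_top hM hWm hWg hW0 hε
  have hupi : Integrable fun x => |u x| ^ p := by
    refine (φ.contDiff_toFun.continuous.abs.rpow_const
      fun _ => Or.inr hp0.le).integrable_of_hasCompactSupport ?_
    exact φ.hasCompactSupport_toFun.comp_left (g := fun t : ℝ => |t| ^ p) (by simp [hp0.ne'])
  have hψi : Integrable ψ := by
    refine (hupi.div_const (ε ^ (p - 1))).mono hψm.aestronglyMeasurable (ae_of_all _ fun x => ?_)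
    rw [Real.norm_of_nonneg (hψ0 x), Real.norm_of_nonneg (by positivity)]
    simp only [hψ]
    gcongr
    linarith [hW0 x]
  obtain ⟨hJi, hJ⟩ := hw.euler_lagrange hι hWm hW hψm hψi hψg φ.hasCompactSupport_toFun
    φ.tsupport_toFun_subset
    (fun x hx => by simp [hψ, hu, image_eq_zero_of_notMem_tsupport hx, hp0.ne'])
  set J : Euc N × Euc N → ℝ := fun z => |diff W z| ^ (p - 2) * diff W z * diff ψ z
  set Q : Euc N × Euc N → ℝ := fun z => (|diff W z| / (W z.1 + ε + (W z.2 + ε))) ^ p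
  have hQ0 : ∀ z, 0 ≤ Q z := fun z =>
    Real.rpow_nonneg (div_nonneg (abs_nonneg _) (add_pos (hWε _) (hWε _)).le) _
  have hpt : ∀ z, c * (Q z * (|u z.1| ^ p + |u z.2| ^ p)) ≤ C * |diff u z| ^ p - J z := fun z => by
    have h := hpic (hWε z.1) (hWε z.2) (abs_nonneg (u z.1)) (abs_nonneg (u z.2))
    rw [add_sub_add_right_eq_sub] at h
    have h5 : C * |(|u z.1| - |u z.2|)| ^ p ≤ C * |diff u z| ^ p :=
      mul_le_mul_of_nonneg_left (Real.rpow_le_rpow (abs_nonneg _)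
        (abs_abs_sub_abs_le_abs_sub _ _) hp0.le) hC.le
    exact le_sub_iff_add_le'.2 (h.trans h5)
  have hdu : Integrable (fun z => C * |diff u z| ^ p) ν := by
    have h := (memLp_diff hp hum φ.gagliardo_ne_top).integrable_norm_rpow (by simpa using hp0)
      ENNReal.ofReal_ne_top
    rw [ENNReal.toReal_ofReal hp0.le] at h
    exact h.const_mul C
  have hpos : ∀ z, 0 ≤ C * |diff u z| ^ p - J z := fun z =>
    (mul_nonneg hc0.le (mul_nonneg (hQ0 z) (by positivity))).trans (hpt z)
  have hint : ∫ z, (C * |diff u z| ^ p - J z) ∂ν = C * (gagliardo s p u).toReal - ∫ x, ψ x := by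
    rw [integral_sub hdu hJi, hJ, integral_const_mul, toReal_gagliardo hp hum]
  set q : Euc N × Euc N → ℝ≥0∞ := fun z =>
    (‖W z.1 - W z.2‖ₑ / ENNReal.ofReal (W z.1 + ε + (W z.2 + ε))) ^ p with hq
  have hqm : Measurable q := by
    have h1 : Measurable fun z : Euc N × Euc N => ‖W z.1 - W z.2‖ₑ := (measurable_diff hWm).enorm
    have h2 : Measurable fun z : Euc N × Euc N => W z.1 + ε + (W z.2 + ε) :=
      ((hWm.comp measurable_fst).add_const ε).add ((hWm.comp measurable_snd).add_const ε)
    exact (h1.div h2.ennreal_ofReal).pow_const p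
  have hqQ : ∀ z, ENNReal.ofReal (Q z) = q z := fun z => by
    simp only [Q, hq]
    rw [← ENNReal.ofReal_rpow_of_nonneg (div_nonneg (abs_nonneg _)
      (add_pos (hWε _) (hWε _)).le) hp0.le, ENNReal.ofReal_div_of_pos (add_pos (hWε _) (hWε _)),
      ← Real.norm_eq_abs, ofReal_norm]
    rfl
  have hup : ∀ x, ENNReal.ofReal (|u x| ^ p) = ‖u x‖ₑ ^ p := fun x => by
    rw [← ENNReal.ofReal_rpow_of_nonneg (abs_nonneg _) hp0.le, ← Real.norm_eq_abs, ofReal_norm]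
  have hum1 : Measurable fun z : Euc N × Euc N => q z * ‖u z.1‖ₑ ^ p :=
    hqm.mul ((hum.comp measurable_fst).enorm.pow_const p)
  have hswap : ∫⁻ z, q z * ‖u z.2‖ₑ ^ p ∂ν = ∫⁻ z, q z * ‖u z.1‖ₑ ^ p ∂ν := by
    rw [← lintegral_kernelMeasure_swap _ hum1]
    refine lintegral_congr fun z => ?_
    simp only [hq, Prod.fst_swap, Prod.snd_swap]
    rw [← enorm_neg (W z.1 - W z.2), neg_sub, add_comm (W z.1 + ε)]
  have hrem : ENNReal.ofReal c * (2 * ∫⁻ z, q z * ‖u z.1‖ₑ ^ p ∂ν) ≤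
      ENNReal.ofReal (C * (gagliardo s p u).toReal - ∫ x, ψ x) := by
    rw [← hint, ofReal_integral_eq_lintegral_ofReal
      (f := fun z => C * |diff u z| ^ p - J z) (hdu.sub hJi) (ae_of_all _ hpos), two_mul]
    nth_rw 2 [← hswap]
    rw [← lintegral_add_left hum1, ← lintegral_const_mul' _ _ ENNReal.ofReal_ne_top]
    refine lintegral_mono fun z => ?_
    refine le_trans (le_of_eq ?_) (ENNReal.ofReal_le_ofReal (hpt z))
    rw [ENNReal.ofReal_mul hc0.le, ENNReal.ofReal_mul (hQ0 z),
      ENNReal.ofReal_add (by positivity) (by positivity), hqQ, hup, hup, ← mul_add]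
  have hfirst : ∫⁻ x, ‖u x‖ₑ ^ p / ENNReal.ofReal (W x + ε) ^ (p - 1) =
      ENNReal.ofReal (∫ x, ψ x) := by
    rw [ofReal_integral_eq_lintegral_ofReal hψi (ae_of_all _ hψ0)]
    refine lintegral_congr fun x => ?_
    simp only [hψ]
    rw [ENNReal.ofReal_div_of_pos (Real.rpow_pos_of_pos (hWε x) _), hup,
      ENNReal.ofReal_rpow_of_pos (hWε x)]
  have hnn : 0 ≤ C * (gagliardo s p u).toReal - ∫ x, ψ x := hint ▸ integral_nonneg hpos
  rw [← lintegral_kernelMeasure _ hum1, hfirst, mul_add]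
  calc _ ≤ ENNReal.ofReal (∫ x, ψ x) +
        ENNReal.ofReal (C * (gagliardo s p u).toReal - ∫ x, ψ x) := by
        gcongr
        exact mul_le_of_le_one_left' (ENNReal.ofReal_le_one.2 hc1)
    _ = ENNReal.ofReal C * gagliardo s p u := by
        rw [← ENNReal.ofReal_add (integral_nonneg hψ0) hnn, add_sub_cancel,
          ENNReal.ofReal_mul hC.le, ENNReal.ofReal_toReal φ.gagliardo_ne_top]

end Regularized

/-! ### Removal of the regularization -/

section Hardy

/-- No positivity of the limit `X` is needed: where `X = 0` and `U ≠ 0` both sides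
are `∞`, and where `U = 0` the left-hand side is `0`. -/
lemma weight_le_liminf {p : ℝ} (hp : 1 < p) {U X : ℝ} {u x : ℕ → ℝ}
    (hu : Tendsto u atTop (𝓝 U)) (hx : Tendsto x atTop (𝓝 X)) :
    ‖U‖ₑ ^ p / ENNReal.ofReal X ^ (p - 1) ≤
      liminf (fun n => ‖u n‖ₑ ^ p / ENNReal.ofReal (x n) ^ (p - 1)) atTop := by
  have hp0 : 0 < p := by linarith
  rcases eq_or_ne U 0 with rfl | hU
  · simp [hp0]
  refine (ENNReal.Tendsto.div ((ENNReal.continuous_rpow_const.tendsto _).comp hu.enorm)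
    (Or.inl ?_) ((ENNReal.continuous_rpow_const.tendsto _).comp (ENNReal.tendsto_ofReal hx))
    (Or.inl ?_)).liminf_eq.ge
  · simp [ENNReal.rpow_eq_zero_iff, hU]
  · exact ENNReal.rpow_ne_top_of_nonneg (by linarith) ENNReal.ofReal_ne_top

lemma remainder_le_liminf {p : ℝ} (hp : 1 < p) {U a b : ℝ} {k : ℝ≥0∞} {u x : ℕ → ℝ}
    (ha : 0 ≤ a) (hb : 0 ≤ b) (hk : k = 0 → a = b) (hu : Tendsto u atTop (𝓝 U))
    (hx : Tendsto x atTop (𝓝 (a + b))) :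
    (‖a - b‖ₑ / ENNReal.ofReal (a + b)) ^ p * ‖U‖ₑ ^ p / k ≤
      liminf (fun n => (‖a - b‖ₑ / ENNReal.ofReal (x n)) ^ p * ‖u n‖ₑ ^ p / k) atTop := by
  have hp0 : 0 < p := by linarith
  rcases eq_or_ne U 0 with rfl | hU
  · simp [hp0]
  rcases eq_or_ne a b with rfl | hab
  · simp [hp0]
  have hpos : 0 < a + b := by
    rcases ha.lt_or_eq with h | h
    · linarith
    · rcases hb.lt_or_eq with h' | h'
      · linarith
      · exact absurd (h.symm.trans h') hab
  have hd : ‖a - b‖ₑ ≠ 0 := by simpa [sub_eq_zero] using hab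
  have h1 : Tendsto (fun n => ‖a - b‖ₑ / ENNReal.ofReal (x n)) atTop
      (𝓝 (‖a - b‖ₑ / ENNReal.ofReal (a + b))) :=
    ENNReal.Tendsto.div tendsto_const_nhds (Or.inl hd) (ENNReal.tendsto_ofReal hx)
      (Or.inl ENNReal.ofReal_ne_top)
  have h2 := (ENNReal.continuous_rpow_const (y := p)).tendsto _ |>.comp h1
  have h3 := (ENNReal.continuous_rpow_const (y := p)).tendsto _ |>.comp hu.enorm
  have hUp : ‖U‖ₑ ^ p ≠ 0 := by simp [ENNReal.rpow_eq_zero_iff, hU]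
  have h4 := ENNReal.Tendsto.mul h2
    (Or.inr (ENNReal.rpow_ne_top_of_nonneg hp0.le enorm_ne_top)) h3 (Or.inl hUp)
  exact (ENNReal.Tendsto.div_const h4 (Or.inr fun h => hab (hk h))).liminf_eq.ge

lemma add_two_mul_le_of_le_liminf {f g b : ℕ → ℝ≥0∞} {A B L : ℝ≥0∞} {c : ℝ≥0∞} (hc : c ≠ ∞)
    (hA : A ≤ liminf f atTop) (hB : B ≤ liminf g atTop) (hb : Tendsto b atTop (𝓝 L))
    (h : ∀ n, c * (f n + 2 * g n) ≤ b n) : c * (A + 2 * B) ≤ L := by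
  have hB' : 2 * B ≤ liminf (fun n => 2 * g n) atTop := by
    rw [ENNReal.liminf_const_mul_of_ne_top ENNReal.ofNat_ne_top]
    gcongr
  have h1 : A + 2 * B ≤ liminf (fun n => f n + 2 * g n) atTop := by
    have hmono : ∀ v : ℕ → ℝ≥0∞, Monotone fun n => ⨅ i ≥ n, v i := fun v m n hmn =>
      le_iInf₂ fun i hi => iInf₂_le i (hmn.trans hi)
    refine (add_le_add hA hB').trans ?_
    rw [liminf_eq_iSup_iInf_of_nat, liminf_eq_iSup_iInf_of_nat, liminf_eq_iSup_iInf_of_nat,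
      ENNReal.iSup_add_iSup_of_monotone (hmono _) (hmono _)]
    exact iSup_mono fun n => le_iInf₂ fun i hi => add_le_add (iInf₂_le i hi) (iInf₂_le i hi)
  rw [← hb.liminf_eq]
  calc c * (A + 2 * B) ≤ c * liminf (fun n => f n + 2 * g n) atTop := by gcongr
    _ = liminf (fun n => c * (f n + 2 * g n)) atTop :=
      (ENNReal.liminf_const_mul_of_ne_top hc).symm
    _ ≤ _ := liminf_le_liminf (Eventually.of_forall h)

variable {N : ℕ} {s p : ℝ} {hs0 : 0 < s} {hs1 : s < 1} {hp : 1 < p} {Ω : Opens (Euc N)}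
  {ι : D0 hs0 hs1 hp Ω →L[ℝ] Lp ℝ 1 ((volume : Measure (Euc N)).restrict Ω)}
  {w : D0 hs0 hs1 hp Ω}

/-- The Hardy inequality with the weights given by a nonnegative representative `W` of the torsion
function, and with the constants of Picone's inequality. -/
lemma IsTorsionFunction.hardy (hι : IsCompactEmbedding ι) (hw : IsTorsionFunction ι w)
    {W : Euc N → ℝ} (hWm : Measurable W) (hW0 : ∀ x, 0 ≤ W x) (hW : rep ι w =ᵐ[volume] W)
    {c C : ℝ} (hc0 : 0 < c) (hc1 : c ≤ 1) (hC : 0 < C)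
    (hpic : ∀ {a b A B : ℝ}, 0 < a → 0 < b → 0 ≤ A → 0 ≤ B →
      |a - b| ^ (p - 2) * (a - b) * (A ^ p / a ^ (p - 1) - B ^ p / b ^ (p - 1)) +
        c * ((|a - b| / (a + b)) ^ p * (A ^ p + B ^ p)) ≤ C * |A - B| ^ p)
    (u : D0 hs0 hs1 hp Ω) :
    ENNReal.ofReal c * ((∫⁻ x, ‖rep ι u x‖ₑ ^ p / ENNReal.ofReal (W x) ^ (p - 1)) +
      2 * ∫⁻ z : Euc N × Euc N,
        (‖W z.1 - W z.2‖ₑ / ENNReal.ofReal (W z.1 + W z.2)) ^ p * ‖rep ι u z.1‖ₑ ^ p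
          / ‖z.1 - z.2‖ₑ ^ ((N : ℝ) + s * p)) ≤
      ENNReal.ofReal C * gagliardo s p (rep ι u) := by
  have hp0 : 0 < p := by linarith
  obtain ⟨φ, hφ, hae⟩ := exists_seq_tendsto_ae hι u
  set ε : ℕ → ℝ := fun n => 1 / ((n : ℝ) + 1)
  have hε : Tendsto ε atTop (𝓝 0) := tendsto_one_div_add_atTop_nhds_zero_nat
  have hε0 : ∀ n, 0 < ε n := fun n => Nat.one_div_pos_of_nat
  have hWε : ∀ x, Tendsto (fun n => W x + ε n) atTop (𝓝 (W x)) := fun x => by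
    simpa using hε.const_add (W x)
  have hb : Tendsto (fun n => ENNReal.ofReal C * gagliardo s p (φ n).toFun) atTop
      (𝓝 (ENNReal.ofReal C * gagliardo s p (rep ι u))) := by
    refine ENNReal.Tendsto.const_mul ?_ (Or.inr ENNReal.ofReal_ne_top)
    rw [gagliardo_rep hι u]
    refine (ENNReal.tendsto_ofReal (hφ.norm.rpow_const (Or.inr hp0.le))).congr fun n => ?_
    rw [UniformSpace.Completion.norm_coe, GagliardoTest.gagliardo_eq_norm]
  refine add_two_mul_le_of_le_liminf ENNReal.ofReal_ne_top ?_ ?_ hb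
    fun n => hw.regularized_hardy hι hWm hW0 hW hc0 hc1 hC hpic (φ n) (hε0 n)
  · refine le_trans (lintegral_mono_ae ?_) (lintegral_liminf_le fun n => ?_)
    · filter_upwards [hae] with x hx
      exact weight_le_liminf hp hx (hWε x)
    · exact ((φ n).measurable_toFun.enorm.pow_const p).div
        ((hWm.add_const (ε n)).ennreal_ofReal.pow_const (p - 1))
  · refine le_trans (lintegral_mono_ae ?_) (lintegral_liminf_le fun n => ?_)
    · filter_upwards [ae_prod_of_ae hae] with z hz
      refine remainder_le_liminf hp (hW0 _) (hW0 _) (fun h => ?_) hz.1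
        ((hWε z.1).add (hWε z.2))
      have hz0 : z.1 - z.2 = 0 := by
        rcases ENNReal.rpow_eq_zero_iff.1 h with h | h
        · exact enorm_eq_zero.1 h.1
        · exact absurd h.1 enorm_ne_top
      rw [sub_eq_zero.1 hz0]
    · have h1 : Measurable fun z : Euc N × Euc N => ‖W z.1 - W z.2‖ₑ := (measurable_diff hWm).enorm
      have h2 : Measurable fun z : Euc N × Euc N => W z.1 + ε n + (W z.2 + ε n) :=
        ((hWm.comp measurable_fst).add_const _).add ((hWm.comp measurable_snd).add_const _)
      exact (((h1.div h2.ennreal_ofReal).pow_const p).mul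
        (((φ n).measurable_toFun.comp measurable_fst).enorm.pow_const p)).div (by fun_prop)

end Hardy

end FracTorsion

theorem theorem4p3 (p : ℝ) (hp : 1 < p) :
    ∃ C : ℝ, 0 < C ∧
      ∀ (N : ℕ) (_hN : 1 ≤ N) (s : ℝ) (hs0 : 0 < s) (hs1 : s < 1)
        (Ω : TopologicalSpace.Opens (EuclideanSpace ℝ (Fin N)))
        (ι : FracTorsion.D0 hs0 hs1 hp Ω →L[ℝ]
          MeasureTheory.Lp ℝ 1 ((volume : Measure (EuclideanSpace ℝ (Fin N))).restrict Ω)),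
        FracTorsion.IsCompactEmbedding ι →
        ∀ w : FracTorsion.D0 hs0 hs1 hp Ω, FracTorsion.IsTorsionFunction ι w →
        ∀ u : FracTorsion.D0 hs0 hs1 hp Ω,
          (∫⁻ x in Ω, ‖FracTorsion.rep ι u x‖ₑ ^ p
              / ENNReal.ofReal (FracTorsion.rep ι w x) ^ (p - 1))
            + 2 * ∫⁻ x, (∫⁻ y,
                (‖FracTorsion.rep ι w x - FracTorsion.rep ι w y‖ₑ
                  / ‖FracTorsion.rep ι w x + FracTorsion.rep ι w y‖ₑ) ^ p
                / ‖x - y‖ₑ ^ ((N : ℝ) + s * p)) * ‖FracTorsion.rep ι u x‖ₑ ^ p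
          ≤ ENNReal.ofReal C * FracTorsion.gagliardo s p (FracTorsion.rep ι u) := by
  open FracTorsion in
  obtain ⟨c, C, hc0, hc1, hC, hpic⟩ := exists_picone hp
  refine ⟨C / c, by positivity, fun N _ s hs0 hs1 Ω ι hι w hw u => ?_⟩
  have hwm : Measurable (rep ι w) := measurable_rep w
  have hum : Measurable (rep ι u) := measurable_rep u
  set W : Euc N → ℝ := fun x => max (rep ι w x) 0
  have hWm : Measurable W := hwm.max measurable_const
  have hW0 : ∀ x, 0 ≤ W x := fun x => le_max_right _ _
  have hW : rep ι w =ᵐ[volume] W := by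
    filter_upwards [hw.nonneg hι] with x hx
    exact (max_eq_left hx).symm
  have h := hw.hardy hι hWm hW0 hW hc0 hc1 hC hpic u
  have e1 : ∫⁻ x in Ω, ‖rep ι u x‖ₑ ^ p / ENNReal.ofReal (rep ι w x) ^ (p - 1) ≤
      ∫⁻ x, ‖rep ι u x‖ₑ ^ p / ENNReal.ofReal (W x) ^ (p - 1) := by
    refine (setLIntegral_le_lintegral _ _).trans (lintegral_mono_ae ?_)
    filter_upwards [hW] with x hx
    rw [hx]
  have e2 : ∫⁻ x, (∫⁻ y, (‖rep ι w x - rep ι w y‖ₑ / ‖rep ι w x + rep ι w y‖ₑ) ^ p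
        / ‖x - y‖ₑ ^ ((N : ℝ) + s * p)) * ‖rep ι u x‖ₑ ^ p =
      ∫⁻ z : Euc N × Euc N,
        (‖W z.1 - W z.2‖ₑ / ENNReal.ofReal (W z.1 + W z.2)) ^ p * ‖rep ι u z.1‖ₑ ^ p
          / ‖z.1 - z.2‖ₑ ^ ((N : ℝ) + s * p) := by
    have hm : Measurable fun z : Euc N × Euc N =>
        (‖rep ι w z.1 - rep ι w z.2‖ₑ / ‖rep ι w z.1 + rep ι w z.2‖ₑ) ^ p
          / ‖z.1 - z.2‖ₑ ^ ((N : ℝ) + s * p) :=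
      (((measurable_diff hwm).enorm.div ((hwm.comp measurable_fst).add
        (hwm.comp measurable_snd)).enorm).pow_const p).div (by fun_prop)
    have hm' : Measurable fun z : Euc N × Euc N =>
        (‖rep ι w z.1 - rep ι w z.2‖ₑ / ‖rep ι w z.1 + rep ι w z.2‖ₑ) ^ p
          / ‖z.1 - z.2‖ₑ ^ ((N : ℝ) + s * p) * ‖rep ι u z.1‖ₑ ^ p :=
      hm.mul ((hum.comp measurable_fst).enorm.pow_const p)
    calc _ = ∫⁻ z : Euc N × Euc N,
          (‖rep ι w z.1 - rep ι w z.2‖ₑ / ‖rep ι w z.1 + rep ι w z.2‖ₑ) ^ p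
            / ‖z.1 - z.2‖ₑ ^ ((N : ℝ) + s * p) * ‖rep ι u z.1‖ₑ ^ p := by
          rw [Measure.volume_eq_prod, lintegral_prod _ hm'.aemeasurable]
          refine lintegral_congr fun x => ?_
          have hx : Measurable fun y => (‖rep ι w x - rep ι w y‖ₑ / ‖rep ι w x + rep ι w y‖ₑ) ^ p
              / ‖x - y‖ₑ ^ ((N : ℝ) + s * p) := by
            have hc := hm.comp (measurable_prodMk_left (x := x))
            exact hc
          exact (lintegral_mul_const _ hx).symm
      _ = _ := by
          refine lintegral_congr_ae ?_
          filter_upwards [ae_prod_of_ae hW] with z hz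
          rw [hz.1, hz.2, Real.enorm_of_nonneg (add_nonneg (hW0 z.1) (hW0 z.2)),
            ENNReal.mul_div_right_comm]
  rw [e2, ENNReal.ofReal_div_of_pos hc0, ENNReal.mul_div_right_comm.symm,
    ENNReal.le_div_iff_mul_le (Or.inl (by simpa using hc0)) (Or.inl ENNReal.ofReal_ne_top),
    mul_comm]
  refine le_trans ?_ h
  gcongr
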